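/- Let $\Gamma$ be a compact metric graph with finitely many edges $e_1,\dots,e_E$ of lengths $l_1,\dots,l_E>0$ (loops and multiple edges allowed), $e_j$ being identified with $[0,l_j]$, and put $l_{\min}=\min_j l_j$. For a function $f=(f_1,\dots,f_E)$ on $\Gamma$ with $f_j\in H^2(0,l_j)$ set $$f_{bv}=\bigl(f_1(0),\dots,f_E(0),f_1(l_1),\dots,f_E(l_E)\bigr)^T,\qquad f'_{bv}=\bigl(f_1'(0),\dots,f_E'(0),-f_1'(l_1),\dots,-f_E'(l_E)\bigr)^T .$$ Let $A,B\in \mathrm{M}(2E,\mathbb C)$ be such that the $2E\times 4E$ matrix $(A,B)$ has rank $2E$ and $AB^*$ is self-adjoint, and let $-\Delta$ be the self-adjoint operator $f\mapsto(-f_1'',\dots,-f_E'')$ on $L^2(\Gamma)=\bigoplus_j L^2(0,l_j)$ with domain $\{f\in\bigoplus_j H^2(0,l_j):\ Af_{bv}+Bf'_{bv}=0\}$. Let $Q$ be the orthogonal projection of $\mathbb C^{2E}$ onto $(\ker B)^\perp=\operatorname{ran}B^*$, let $L=(B|_{\operatorname{ran}B^*})^{-1}AQ$, a self-adjoint endomorphism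 of $\operatorname{ran}B^*$, and let $\lambda^+_{\min}\in(0,\infty]$ be the smallest positive eigenvalue of $L$, with $\lambda^+_{\min}=\infty$ if there is none. For complex $k$ with $A+\mathrm i kB$ invertible (in particular near every $k\in\mathbb R\setminus\{0\}$) put $$S(k)=-(A+\mathrm i kB)^{-1}(A-\mathrm i kB),\quad T(k)=\begin{pmatrix}0&t(k)\\ t(k)&0\end{pmatrix},\quad t(k)=\operatorname{diag}\bigl(\mathrm e^{\mathrm i kl_1},\dots,\mathrm e^{\mathrm i kl_E}\bigr),$$ $$U(k)=S(k)\,T(k),\qquad F(k)=\det\bigl(\mathbf 1-U(k)\bigr).$$ Suppose that $l_{\min}>2/\lambda^+_{\min}$ (with $2/\infty=0$). Then for every real $k\neq0$ and every integer $g\ge1$ the following are equivalent: 1. $k^2$ is an eigenvalue of $-\Delta$ of multiplicity $g$; 2. $k$ is a zero of $F$ of order $g$; 3. $-k$ is a zero of $F$ of order $g$. In particular, $k^2>0$ is a Laplace eigenvalue of multiplicity $g$ exactly when $\pm k$ are zeros of $F$ of order $g$. -/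

import Mathlib

open MeasureTheory Set
open scoped ENNReal InnerProductSpace

noncomputable section

namespace QuantumGraph

/-- A metric graph with vertices `V` and edges `E`; loops and multiple edges are allowed.  The edge
`e` is identified with the interval `[0, length e]`, where `0` is its initial point `initial e` and
`length e` its terminal point `terminal e`. -/
structure MetricGraph (V E : Type*) where
  initial : E → V
  terminal : E → V
  length : E → ℝ
  length_pos : ∀ e, 0 < length e

/-- Self-adjoint boundary conditions `A F_bv + B F'_bv = 0`.  The `2|E|` edge ends are indexed by
`E ⊕ E`: first all initial points, then all terminal points. -/
structure BoundaryCondition (E : Type*) [Fintype E] [DecidableEq E] where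
  A : Matrix (E ⊕ E) (E ⊕ E) ℂ
  B : Matrix (E ⊕ E) (E ⊕ E) ℂ
  rank_eq : (Matrix.fromCols A B).rank = Fintype.card (E ⊕ E)
  isHermitian : (A * B.conjTranspose).IsHermitian

variable {V E : Type*} [Fintype E] [DecidableEq E]

/-! ### Function spaces and the Laplacian -/

/-- The Hilbert space `L²(Γ) = ⨁ₑ L²(0, lₑ)`. -/
abbrev MetricGraph.L2 (Γ : MetricGraph V E) : Type _ :=
  PiLp 2 (fun e : E => Lp ℂ 2 (volume.restrict (Ioo 0 (Γ.length e))))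

/-- `f` restricted to `[0, l]` is the continuously differentiable representative of an element of
the Sobolev space `H²(0, l)`, with derivative `f₁` (absolutely continuous) and weak second
derivative `f₂ ∈ L²(0, l)`. -/
structure IsSobolevTwo (l : ℝ) (f f₁ : ℝ → ℂ) (f₂ : Lp ℂ 2 (volume.restrict (Ioo 0 l))) :
    Prop where
  eq_integral : ∀ x ∈ Icc 0 l, f x = f 0 + ∫ t in (0 : ℝ)..x, f₁ t
  deriv_eq_integral : ∀ x ∈ Icc 0 l, f₁ x = f₁ 0 + ∫ t in (0 : ℝ)..x, f₂ t

/-- The boundary values `F_bv = (f₁(0), …, f_E(0), f₁(l₁), …, f_E(l_E))`. -/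
def MetricGraph.bv (Γ : MetricGraph V E) (f : E → ℝ → ℂ) : E ⊕ E → ℂ :=
  Sum.elim (fun e => f e 0) (fun e => f e (Γ.length e))

/-- The inward boundary derivatives `F'_bv = (f₁'(0), …, f_E'(0), -f₁'(l₁), …, -f_E'(l_E))`. -/
def MetricGraph.bvDeriv (Γ : MetricGraph V E) (f' : E → ℝ → ℂ) : E ⊕ E → ℂ :=
  Sum.elim (fun e => f' e 0) (fun e => -f' e (Γ.length e))

/-- `Φ ∈ L²(Γ)` has components in `H²(0, lₑ)`, satisfies the boundary conditions, and has second
derivative `D ∈ L²(Γ)`. -/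
def HasSecondDeriv (Γ : MetricGraph V E) (bc : BoundaryCondition E) (Φ D : Γ.L2) : Prop :=
  ∃ f f' : E → ℝ → ℂ,
    (∀ e, f e =ᵐ[volume.restrict (Ioo 0 (Γ.length e))] Φ e) ∧
    (∀ e, IsSobolevTwo (Γ.length e) (f e) (f' e) (D e)) ∧
    bc.A.mulVec (Γ.bv f) + bc.B.mulVec (Γ.bvDeriv f') = 0

lemma integral_congr_Ioo {l : ℝ} {f g : ℝ → ℂ} (h : f =ᵐ[volume.restrict (Ioo 0 l)] g) {x : ℝ}
    (hx : x ∈ Icc 0 l) : ∫ t in (0 : ℝ)..x, f t = ∫ t in (0 : ℝ)..x, g t := by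
  rw [intervalIntegral.integral_of_le hx.1, intervalIntegral.integral_of_le hx.1]
  rw [Measure.restrict_congr_set Ioo_ae_eq_Ioc] at h
  exact integral_congr_ae (ae_restrict_of_ae_restrict_of_subset (Ioc_subset_Ioc_right hx.2) h)

lemma intervalIntegrable_of_Lp {l : ℝ} (g : Lp ℂ 2 (volume.restrict (Ioo 0 l))) {x : ℝ}
    (hx : x ∈ Icc 0 l) : IntervalIntegrable g volume 0 x := by
  have h : IntegrableOn g (Ioo 0 l) volume := (Lp.memLp g).integrable (by norm_num)
  rw [intervalIntegrable_iff_integrableOn_Ioc_of_le hx.1]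
  exact ((integrableOn_Ioc_iff_integrableOn_Ioo (by simp)).2 h).mono_set (Ioc_subset_Ioc_right hx.2)

lemma IsSobolevTwo.continuousOn_deriv {l : ℝ} (hl : 0 < l) {f f₁ : ℝ → ℂ}
    {f₂ : Lp ℂ 2 (volume.restrict (Ioo 0 l))} (h : IsSobolevTwo l f f₁ f₂) :
    ContinuousOn f₁ (Icc 0 l) := by
  have hi := intervalIntegrable_of_Lp f₂ (right_mem_Icc.2 hl.le)
  have := intervalIntegral.continuousOn_primitive_interval' hi left_mem_uIcc
  rw [uIcc_of_le hl.le] at this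
  exact (continuousOn_const.add this).congr h.deriv_eq_integral

lemma IsSobolevTwo.intervalIntegrable {l : ℝ} (hl : 0 < l) {f f₁ : ℝ → ℂ}
    {f₂ : Lp ℂ 2 (volume.restrict (Ioo 0 l))} (h : IsSobolevTwo l f f₁ f₂) {x : ℝ}
    (hx : x ∈ Icc 0 l) : IntervalIntegrable f₁ volume 0 x :=
  ((h.continuousOn_deriv hl).mono (by
    rw [uIcc_of_le hx.1]; exact Icc_subset_Icc_right hx.2)).intervalIntegrable

lemma IsSobolevTwo.add {l : ℝ} (hl : 0 < l) {f f₁ g g₁ : ℝ → ℂ}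
    {f₂ g₂ : Lp ℂ 2 (volume.restrict (Ioo 0 l))} (hf : IsSobolevTwo l f f₁ f₂)
    (hg : IsSobolevTwo l g g₁ g₂) : IsSobolevTwo l (f + g) (f₁ + g₁) (f₂ + g₂) := by
  refine ⟨fun x hx => ?_, fun x hx => ?_⟩
  · have := intervalIntegral.integral_add (hf.intervalIntegrable hl hx)
      (hg.intervalIntegrable hl hx)
    simp only [Pi.add_apply, this]
    rw [hf.eq_integral x hx, hg.eq_integral x hx]
    ring
  · have h1 := intervalIntegral.integral_add (intervalIntegrable_of_Lp f₂ hx)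
      (intervalIntegrable_of_Lp g₂ hx)
    have h2 : ∫ t in (0 : ℝ)..x, (f₂ + g₂ : Lp ℂ 2 (volume.restrict (Ioo 0 l))) t
        = ∫ t in (0 : ℝ)..x, (f₂ t + g₂ t) :=
      integral_congr_Ioo (Lp.coeFn_add f₂ g₂) hx
    rw [h2, h1]
    simp only [Pi.add_apply]
    rw [hf.deriv_eq_integral x hx, hg.deriv_eq_integral x hx]
    ring

lemma IsSobolevTwo.smul {l : ℝ} (c : ℂ) {f f₁ : ℝ → ℂ}
    {f₂ : Lp ℂ 2 (volume.restrict (Ioo 0 l))} (hf : IsSobolevTwo l f f₁ f₂) :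
    IsSobolevTwo l (c • f) (c • f₁) (c • f₂) := by
  refine ⟨fun x hx => ?_, fun x hx => ?_⟩
  · simp only [Pi.smul_apply, intervalIntegral.integral_smul]
    rw [hf.eq_integral x hx, smul_add]
  · have h2 : ∫ t in (0 : ℝ)..x, (c • f₂ : Lp ℂ 2 (volume.restrict (Ioo 0 l))) t
        = ∫ t in (0 : ℝ)..x, c • f₂ t :=
      integral_congr_Ioo (Lp.coeFn_smul c f₂) hx
    rw [h2]
    simp only [Pi.smul_apply, intervalIntegral.integral_smul]
    rw [hf.deriv_eq_integral x hx, smul_add]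

/-- The graph of `-Δ(A, B, l)`, as a subspace of `L²(Γ) × L²(Γ)`: all pairs `(F, -F'')` with `F` in
the domain of the operator. -/
def laplacianGraph (Γ : MetricGraph V E) (bc : BoundaryCondition E) :
    Submodule ℂ (Γ.L2 × Γ.L2) where
  carrier := {p | HasSecondDeriv Γ bc p.1 (-p.2)}
  zero_mem' := by
    refine ⟨0, 0, fun e => ?_, fun e => ⟨fun x hx => ?_, fun x hx => ?_⟩, ?_⟩
    · exact (Lp.coeFn_zero _ _ _).symm
    · simp
    · have : ∫ t in (0 : ℝ)..x, (0 : Lp ℂ 2 (volume.restrict (Ioo 0 (Γ.length e)))) t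
          = ∫ t in (0 : ℝ)..x, (0 : ℂ) :=
        integral_congr_Ioo (Lp.coeFn_zero ℂ 2 (volume.restrict (Ioo 0 (Γ.length e)))) hx
      simpa using this.symm
    · have h1 : Γ.bv 0 = 0 := by ext i; cases i <;> simp [MetricGraph.bv]
      have h2 : Γ.bvDeriv 0 = 0 := by ext i; cases i <;> simp [MetricGraph.bvDeriv]
      simp [h1, h2]
  add_mem' := by
    rintro p q ⟨f, f', h1, h2, h3⟩ ⟨g, g', k1, k2, k3⟩
    refine ⟨f + g, f' + g', fun e => ?_, fun e => ?_, ?_⟩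
    · exact ((h1 e).add (k1 e)).trans (Lp.coeFn_add _ _).symm
    · have := (h2 e).add (Γ.length_pos e) (k2 e)
      have e1 : (-(p + q).2) e = (-p.2) e + (-q.2) e := by
        simp only [Prod.snd_add, PiLp.neg_apply, PiLp.add_apply]; abel
      rw [e1]; exact this
    · have e1 : Γ.bv (f + g) = Γ.bv f + Γ.bv g := by
        ext i; cases i <;> simp [MetricGraph.bv]
      have e2 : Γ.bvDeriv (f' + g') = Γ.bvDeriv f' + Γ.bvDeriv g' := by
        ext i; cases i <;> simp [MetricGraph.bvDeriv]; ring
      rw [e1, e2, Matrix.mulVec_add, Matrix.mulVec_add, add_add_add_comm, h3, k3, add_zero]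
  smul_mem' := by
    rintro c p ⟨f, f', h1, h2, h3⟩
    refine ⟨c • f, c • f', fun e => ?_, fun e => ?_, ?_⟩
    · exact ((h1 e).const_smul c).trans (Lp.coeFn_smul _ _).symm
    · have e1 : (-(c • p).2) e = c • (-p.2) e := by
        simp only [Prod.smul_snd, PiLp.neg_apply, PiLp.smul_apply, smul_neg]
      rw [e1]; exact (h2 e).smul c
    · have e1 : Γ.bv (c • f) = c • Γ.bv f := by
        ext i; cases i <;> simp [MetricGraph.bv]
      have e2 : Γ.bvDeriv (c • f') = c • Γ.bvDeriv f' := by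
        ext i; cases i <;> simp [MetricGraph.bvDeriv]
      rw [e1, e2, Matrix.mulVec_smul, Matrix.mulVec_smul, ← smul_add, h3, smul_zero]

/-- The negative Laplacian `-Δ(A, B, l)` as an unbounded operator on `L²(Γ)`. -/
def laplacian (Γ : MetricGraph V E) (bc : BoundaryCondition E) : Γ.L2 →ₗ.[ℂ] Γ.L2 :=
  (laplacianGraph Γ bc).toLinearPMap

lemma eq_zero_of_primitive_eq_zero {l : ℝ} (hl : 0 < l) {f : ℝ → ℂ}
    (hf : ContinuousOn f (Icc 0 l)) (h : ∀ x ∈ Icc 0 l, ∫ t in (0 : ℝ)..x, f t = 0) :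
    ∀ x ∈ Icc 0 l, f x = 0 := by
  have hd : ∀ x ∈ Ioo 0 l, f x = 0 := by
    intro x hx
    have hxI : x ∈ Icc 0 l := Ioo_subset_Icc_self hx
    have hca : ContinuousAt f x := hf.continuousAt (Icc_mem_nhds hx.1 hx.2)
    have hi : IntervalIntegrable f volume 0 x :=
      (hf.mono (by rw [uIcc_of_le hxI.1]; exact Icc_subset_Icc_right hxI.2)).intervalIntegrable
    have hm : StronglyMeasurableAtFilter f (nhds x) volume :=
      (hf.mono Ioo_subset_Icc_self).stronglyMeasurableAtFilter isOpen_Ioo x hx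
    have h1 := intervalIntegral.integral_hasDerivAt_right hi hm hca
    have h2 : (fun u => ∫ t in (0 : ℝ)..u, f t) =ᶠ[nhds x] fun _ => 0 := by
      filter_upwards [Icc_mem_nhds hx.1 hx.2] with u hu using h u hu
    exact h1.unique ((hasDerivAt_const x (0 : ℂ)).congr_of_eventuallyEq h2)
  have hcl : closure (Ioo 0 l) = Icc 0 l := closure_Ioo hl.ne
  have := Set.EqOn.of_subset_closure (f := f) (g := fun _ => 0) (s := Ioo 0 l) (t := Icc 0 l)
    hd hf continuousOn_const Ioo_subset_Icc_self hcl.ge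
  exact this

lemma laplacianGraph_functional (Γ : MetricGraph V E) (bc : BoundaryCondition E)
    (p : Γ.L2 × Γ.L2) (hp : p ∈ laplacianGraph Γ bc) (hp1 : p.1 = 0) : p.2 = 0 := by
  obtain ⟨f, f', h1, h2, -⟩ := hp
  refine PiLp.ext fun e => ?_
  set l := Γ.length e with hl
  have hpos : 0 < l := Γ.length_pos e
  have hz : f e =ᵐ[volume.restrict (Ioo 0 l)] 0 := by
    have := h1 e
    rw [hp1] at this
    exact this.trans (Lp.coeFn_zero _ _ _)
  have hfc : ContinuousOn (f e) (Icc 0 l) := by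
    have := intervalIntegral.continuousOn_primitive_interval'
      ((h2 e).intervalIntegrable hpos (right_mem_Icc.2 hpos.le)) left_mem_uIcc
    rw [uIcc_of_le hpos.le] at this
    exact (continuousOn_const.add this).congr (h2 e).eq_integral
  have hf0 : ∀ x ∈ Icc 0 l, f e x = 0 := by
    refine eq_zero_of_primitive_eq_zero hpos hfc fun x hx => ?_
    rw [integral_congr_Ioo hz hx]
    simp
  have hf1 : ∀ x ∈ Icc 0 l, f' e x = 0 := by
    refine eq_zero_of_primitive_eq_zero hpos ((h2 e).continuousOn_deriv hpos) fun x hx => ?_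
    have := (h2 e).eq_integral x hx
    rw [hf0 x hx, hf0 0 (left_mem_Icc.2 hpos.le), zero_add] at this
    exact this.symm
  have hg : ∀ x ∈ Icc 0 l, ∫ t in (0 : ℝ)..x, ((-p.2) e) t = 0 := by
    intro x hx
    have := (h2 e).deriv_eq_integral x hx
    rw [hf1 x hx, hf1 0 (left_mem_Icc.2 hpos.le), zero_add] at this
    exact this.symm
  have hd := (intervalIntegrable_of_Lp ((-p.2) e) (right_mem_Icc.2 hpos.le)).ae_hasDerivAt_integral
  have hae : ((-p.2) e : ℝ → ℂ) =ᵐ[volume.restrict (Ioo 0 l)] 0 := by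
    rw [Filter.EventuallyEq, ae_restrict_iff' measurableSet_Ioo]
    filter_upwards [hd] with x hx hxI
    have hx' : x ∈ uIcc 0 l := by rw [uIcc_of_le hpos.le]; exact Ioo_subset_Icc_self hxI
    have h1 := hx hx' 0 left_mem_uIcc
    have h2 : (fun u => ∫ t in (0 : ℝ)..u, ((-p.2) e) t) =ᶠ[nhds x] fun _ => 0 := by
      filter_upwards [Icc_mem_nhds hxI.1 hxI.2] with u hu using hg u hu
    exact h1.unique ((hasDerivAt_const x (0 : ℂ)).congr_of_eventuallyEq h2)
  have : (-p.2) e = 0 := Lp.ext (hae.trans (Lp.coeFn_zero _ _ _).symm)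
  simpa using this

/-- The operator `laplacian` really has the graph from which it is built. -/
lemma laplacian_graph (Γ : MetricGraph V E) (bc : BoundaryCondition E) :
    (laplacian Γ bc).graph = laplacianGraph Γ bc :=
  Submodule.toLinearPMap_graph_eq _ (laplacianGraph_functional Γ bc)

/-- The space of all `x` in the domain of the unbounded operator `T` with `T x = μ x`. -/
def opEigenspace {H : Type*} [AddCommGroup H] [Module ℂ H] (T : H →ₗ.[ℂ] H) (μ : ℂ) :
    Submodule ℂ T.domain :=
  LinearMap.ker (T.toFun - μ • T.domain.subtype)

/-- `μ` is an eigenvalue of the unbounded operator `T`, and its eigenspace has finite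
dimension `g`. -/
def IsEigenvalueOfMultiplicity {H : Type*} [AddCommGroup H] [Module ℂ H] (T : H →ₗ.[ℂ] H)
    (μ : ℂ) (g : ℕ) : Prop :=
  opEigenspace T μ ≠ ⊥ ∧ FiniteDimensional ℂ (opEigenspace T μ) ∧
    Module.finrank ℂ (opEigenspace T μ) = g

/-! ### The endomorphism `L` -/

namespace BoundaryCondition

variable (bc : BoundaryCondition E)

def linA : EuclideanSpace ℂ (E ⊕ E) →ₗ[ℂ] EuclideanSpace ℂ (E ⊕ E) := Matrix.toEuclideanLin bc.A

def linB : EuclideanSpace ℂ (E ⊕ E) →ₗ[ℂ] EuclideanSpace ℂ (E ⊕ E) := Matrix.toEuclideanLin bc.B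

/-- The subspace `(ker B)ᗮ = ran B*` of `ℂ^{2|E|}`. -/
abbrev ranBstar : Submodule ℂ (EuclideanSpace ℂ (E ⊕ E)) := (LinearMap.ker bc.linB)ᗮ

/-- `B` as a map from `ran B*` to `ran B`. -/
def restrictB : bc.ranBstar →ₗ[ℂ] LinearMap.range bc.linB :=
  bc.linB.rangeRestrict ∘ₗ bc.ranBstar.subtype

lemma restrictB_bijective : Function.Bijective bc.restrictB := by
  constructor
  · rw [← LinearMap.ker_eq_bot, LinearMap.ker_eq_bot']
    rintro ⟨x, hx⟩ h
    have hk : x ∈ LinearMap.ker bc.linB := by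
      simpa [restrictB, Subtype.ext_iff] using h
    have : inner ℂ x x = 0 := (Submodule.mem_orthogonal _ _).1 hx x hk
    exact Subtype.ext (inner_self_eq_zero.1 this)
  · rintro ⟨_, y, rfl⟩
    obtain ⟨u, hu, v, hv, rfl⟩ := (LinearMap.ker bc.linB).exists_add_mem_mem_orthogonal y
    refine ⟨⟨v, hv⟩, Subtype.ext ?_⟩
    simp only [restrictB, LinearMap.comp_apply, Submodule.subtype_apply, LinearMap.map_add,
      LinearMap.codRestrict_apply, LinearMap.rangeRestrict, LinearMap.mem_ker.1 hu, zero_add]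

lemma linA_mem_range (x : bc.ranBstar) : bc.linA x ∈ LinearMap.range bc.linB := by
  have hx : (x : EuclideanSpace ℂ (E ⊕ E)) ∈
      LinearMap.range (Matrix.toEuclideanLin bc.B.conjTranspose) := by
    rw [Matrix.toEuclideanLin_conjTranspose_eq_adjoint]
    exact (LinearMap.orthogonal_ker bc.linB) ▸ x.2
  obtain ⟨y, hy⟩ := hx
  have hH : bc.A * bc.B.conjTranspose = bc.B * bc.A.conjTranspose := by
    have := bc.isHermitian.eq
    rw [Matrix.conjTranspose_mul, Matrix.conjTranspose_conjTranspose] at this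
    exact this.symm
  refine ⟨Matrix.toEuclideanLin bc.A.conjTranspose y, ?_⟩
  rw [← hy]
  simp only [linA, linB, Matrix.toLpLin_apply, Matrix.mulVec_mulVec, hH]

/-- The endomorphism `L = (B|_{ran B*})⁻¹ A Q` of `ran B*`. -/
def L : Module.End ℂ bc.ranBstar :=
  (LinearEquiv.ofBijective bc.restrictB bc.restrictB_bijective).symm.toLinearMap ∘ₗ
    (bc.linA ∘ₗ bc.ranBstar.subtype).codRestrict (LinearMap.range bc.linB) bc.linA_mem_range

/-- `λ⁺_min`: the smallest positive eigenvalue of `L`, and `∞` if `L` has no positive eigenvalue. -/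
def lambdaPlusMin : ℝ≥0∞ :=
  ⨅ μ ∈ {μ : ℝ | 0 < μ ∧ bc.L.HasEigenvalue (μ : ℂ)}, ENNReal.ofReal μ

/-! ### The secular function -/

/-- The edge S-matrix `S(A, B; k) = -(A + ikB)⁻¹ (A - ikB)`.  Wherever `A + ikB` is invertible, in
particular in a complex neighbourhood of every nonzero real `k`, this is the meromorphic
continuation of the S-matrix. -/
def S (k : ℂ) : Matrix (E ⊕ E) (E ⊕ E) ℂ :=
  -((bc.A + (Complex.I * k) • bc.B)⁻¹ * (bc.A - (Complex.I * k) • bc.B))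

end BoundaryCondition

/-- The shortest edge length. -/
def MetricGraph.lMin (Γ : MetricGraph V E) : ℝ≥0∞ := ⨅ e, ENNReal.ofReal (Γ.length e)

def MetricGraph.t (Γ : MetricGraph V E) (k : ℂ) : Matrix E E ℂ :=
  Matrix.diagonal fun e => Complex.exp (Complex.I * k * Γ.length e)

def MetricGraph.T (Γ : MetricGraph V E) (k : ℂ) : Matrix (E ⊕ E) (E ⊕ E) ℂ :=
  Matrix.fromBlocks 0 (Γ.t k) (Γ.t k) 0

/-- `U(k) = S(A, B; k) T(l; k)`. -/
def U (Γ : MetricGraph V E) (bc : BoundaryCondition E) (k : ℂ) : Matrix (E ⊕ E) (E ⊕ E) ℂ :=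
  bc.S k * Γ.T k

/-- `F(k) = det(1 - U(k))`. -/
def secularF (Γ : MetricGraph V E) (bc : BoundaryCondition E) (k : ℂ) : ℂ :=
  (1 - U Γ bc k).det

/-- The function `F`, analytic at `z`, has a zero of exact finite order `g ≥ 1` at `z`. -/
def IsZeroOfOrder (F : ℂ → ℂ) (z : ℂ) (g : ℕ) : Prop :=
  0 < g ∧ AnalyticAt ℂ F z ∧ analyticOrderAt F z = g

end QuantumGraph

end

namespace QuantumGraph

/-! ### The order of vanishing of a determinant -/

/-! The theorem rests on one number, `dim ker (1 - U k)` for real `k ≠ 0`, which is both the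
multiplicity of `k²` and the order of `k` as a zero of `F`.

Multiplicity: on each edge a solution of `-f'' = k² f` is a sum of two plane waves. For outgoing
amplitudes `a` the boundary condition reads `(A + ikB)(1 - U k) a = 0`, and `A + ikB` is invertible.
So the eigenspace is isomorphic to `ker (1 - U k)` (`nonempty_opEigenspace_equiv`). This half needs
no condition on the lengths.

Order: the determinant of an analytic family `M` vanishes to order `dim ker (M k)` as soon as `M' k`
induces an injection from the kernel to the cokernel (`analyticOrderAt_det`). For `M = 1 - U` let
`p` be fixed by `U k` with `M' p` in the range of `M`. As `U k` is unitary, that range is orthogonal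
to `p`, so `⟨p, M' p⟩ = 0`. In an eigenbasis of `L`, completed by a basis of `ker B`, the matrix `S`
is diagonal with unimodular entries, and `⟨p, M' p⟩ = i (∑ κᵢ |cᵢ|² - ∑ dᵢ |pᵢ|²)`. Here `c` is `p`
in that basis, the `dᵢ` are edge lengths, and `κᵢ` is `2μ/(μ² + k²)` for an eigenvalue `μ` of `L`,
or `0` on `ker B`. Since `κᵢ ≤ 2/λ⁺_min < l_min ≤ dᵢ` and `|c| = |p|`, this forces `p = 0`
(`eq_zero_of_derivative_mem_range`). -/

lemma analyticAt_det {n : Type*} [Fintype n] [DecidableEq n] {M : ℂ → Matrix n n ℂ} {z₀ : ℂ}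
    (h : ∀ i j, AnalyticAt ℂ (fun z => M z i j) z₀) : AnalyticAt ℂ (fun z => (M z).det) z₀ := by
  simp only [Matrix.det_apply']
  refine Finset.analyticAt_fun_sum _ fun σ _ => analyticAt_const.mul ?_
  exact Finset.analyticAt_fun_prod _ fun i _ => h _ _

/-- A matrix `X` whose columns form a basis of the kernel of `M`, with a left inverse `Y`. -/
lemma exists_ker_parametrization {n : Type*} [Fintype n] [DecidableEq n] (M : Matrix n n ℂ) :
    ∃ (X : Matrix n (Fin (Module.finrank ℂ (LinearMap.ker M.mulVecLin))) ℂ)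
      (Y : Matrix (Fin (Module.finrank ℂ (LinearMap.ker M.mulVecLin))) n ℂ),
      Y * X = 1 ∧ M * X = 0 ∧ ∀ v, M.mulVec v = 0 → (X * Y).mulVec v = v := by
  set K := LinearMap.ker M.mulVecLin
  let b := Module.finBasis ℂ K
  let φ : (Fin (Module.finrank ℂ K) → ℂ) →ₗ[ℂ] (n → ℂ) :=
    K.subtype ∘ₗ b.equivFun.symm.toLinearMap
  have hφ : LinearMap.ker φ = ⊥ := by
    rw [LinearMap.ker_eq_bot]
    exact K.injective_subtype.comp b.equivFun.symm.injective
  obtain ⟨ψ, hψ⟩ := φ.exists_leftInverse_of_injective hφ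
  have hX : ∀ w, (LinearMap.toMatrix' φ).mulVec w = φ w := LinearMap.toMatrix'_mulVec φ
  have hY : ∀ w, (LinearMap.toMatrix' ψ).mulVec w = ψ w := LinearMap.toMatrix'_mulVec ψ
  refine ⟨LinearMap.toMatrix' φ, LinearMap.toMatrix' ψ, ?_, ?_, fun v hv => ?_⟩
  · rw [← LinearMap.toMatrix'_comp, hψ, LinearMap.toMatrix'_id]
  · refine Matrix.toLin'.injective (LinearMap.ext fun w => ?_)
    rw [map_zero, LinearMap.zero_apply, Matrix.toLin'_apply, ← Matrix.mulVec_mulVec, hX]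
    exact (b.equivFun.symm w).2
  · rw [← Matrix.mulVec_mulVec, hX, hY]
    obtain ⟨w, hw⟩ : ∃ w, φ w = v :=
      ⟨b.equivFun (⟨v, hv⟩ : K), congrArg Subtype.val (b.equivFun.symm_apply_apply (⟨v, hv⟩ : K))⟩
    rw [← hw]
    exact congrArg φ (LinearMap.congr_fun hψ w)

/-- If the derivative of an analytic family of matrices induces an injective map from the kernel
to the cokernel at `z₀`, then the determinant vanishes at `z₀` to the order given by the dimension
of the kernel. -/
lemma analyticOrderAt_det {n : Type*} [Fintype n] [DecidableEq n] {M R : ℂ → Matrix n n ℂ} {z₀ : ℂ}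
    (hR : ∀ i j, AnalyticAt ℂ (fun z => R z i j) z₀)
    (hM : ∀ᶠ z in nhds z₀, M z = M z₀ + (z - z₀) • R z)
    (hnd : ∀ p u, (M z₀).mulVec p = 0 → (R z₀).mulVec p = (M z₀).mulVec u → p = 0) :
    AnalyticAt ℂ (fun z => (M z).det) z₀ ∧
      analyticOrderAt (fun z => (M z).det) z₀ =
        Module.finrank ℂ (LinearMap.ker (M z₀).mulVecLin) := by
  obtain ⟨X, Y, hYX, hMX, hXY⟩ := exists_ker_parametrization (M z₀)
  have hMij : ∀ i j, AnalyticAt ℂ (fun z => (M z₀ + (z - z₀) • R z) i j) z₀ := by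
    intro i j
    simp only [Matrix.add_apply, Matrix.smul_apply, smul_eq_mul]
    exact analyticAt_const.add ((analyticAt_id.sub analyticAt_const).mul (hR i j))
  have han : AnalyticAt ℂ (fun z => (M z).det) z₀ :=
    (analyticAt_det hMij).congr (hM.mono fun z hz => by simp only [hz])
  refine ⟨han, ?_⟩
  rw [han.analyticOrderAt_eq_natCast]
  -- `P = X * Y` is a projection onto `ker (M z₀)`. On its range `M z` equals `(z - z₀) • R z`; `N`
  -- drops this scalar factor there and agrees with `M` on `ker P`. Hence `M z = N z * (1 + (z - z₀
  -- - 1) • P)`, and the second factor carries the whole zero provided `N z₀` is invertible.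
  let N : ℂ → Matrix n n ℂ := fun z =>
    R z * (X * Y) + (M z₀ + (z - z₀) • R z) * (1 - X * Y)
  refine ⟨fun z => (N z).det, analyticAt_det fun i j => ?_, ?_, ?_⟩
  · simp only [N, Matrix.add_apply (R _ * _), Matrix.mul_apply (N := X * Y),
      Matrix.mul_apply (N := 1 - X * Y)]
    exact (Finset.analyticAt_fun_sum _ fun l _ => (hR i l).mul analyticAt_const).add
      (Finset.analyticAt_fun_sum _ fun l _ => (hMij i l).mul analyticAt_const)
  · intro h0
    obtain ⟨v, hv0, hv⟩ := Matrix.exists_mulVec_eq_zero_iff.2 h0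
    have hMP : M z₀ * (X * Y) = 0 := by rw [← Matrix.mul_assoc, hMX, Matrix.zero_mul]
    have hN : N z₀ = R z₀ * (X * Y) + M z₀ := by
      simp only [N, sub_self, zero_smul, add_zero, Matrix.mul_sub, hMP, Matrix.mul_one, sub_zero]
    rw [hN, Matrix.add_mulVec, ← Matrix.mulVec_mulVec] at hv
    have hp : (X * Y).mulVec v = 0 := by
      refine hnd _ (-v) ?_ ?_
      · rw [Matrix.mulVec_mulVec, hMP, Matrix.zero_mulVec]
      · rw [Matrix.mulVec_neg]; exact eq_neg_of_add_eq_zero_left hv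
    rw [hp, Matrix.mulVec_zero, zero_add] at hv
    exact hv0 (by rw [← hXY v hv, hp])
  · filter_upwards [hM] with z hz
    have hP2 : (X * Y) * (X * Y) = X * Y := by
      rw [Matrix.mul_assoc, ← Matrix.mul_assoc Y, hYX, Matrix.one_mul]
    have hMP : M z₀ * (X * Y) = 0 := by rw [← Matrix.mul_assoc, hMX, Matrix.zero_mul]
    -- Exchanging `X` and `Y` in `det (1 + X Y)` reduces this to the determinant of a scalar matrix
    -- on the kernel.
    have hdet : (1 + (z - z₀ - 1) • (X * Y)).det
        = (z - z₀) ^ Module.finrank ℂ (LinearMap.ker (M z₀).mulVecLin) := by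
      rw [← Matrix.smul_mul, Matrix.det_one_add_mul_comm, Matrix.mul_smul, hYX]
      rw [show (1 : Matrix (Fin (Module.finrank ℂ (LinearMap.ker (M z₀).mulVecLin)))
        (Fin (Module.finrank ℂ (LinearMap.ker (M z₀).mulVecLin))) ℂ) + (z - z₀ - 1) • 1
        = (z - z₀) • 1 by rw [sub_smul (z - z₀), one_smul]; abel]
      rw [Matrix.det_smul, Matrix.det_one, mul_one, Fintype.card_fin]
    have hfac : M z = N z * (1 + (z - z₀ - 1) • (X * Y)) := by
      have h1 : (1 - X * Y) * (X * Y) = 0 := by rw [Matrix.sub_mul, Matrix.one_mul, hP2, sub_self]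
      have h2 : (M z₀ + (z - z₀) • R z) * (X * Y) = (z - z₀) • (R z * (X * Y)) := by
        rw [Matrix.add_mul, hMP, zero_add, Matrix.smul_mul]
      have h3 : N z * (X * Y) = R z * (X * Y) := by
        rw [Matrix.add_mul, Matrix.mul_assoc (R z), hP2, Matrix.mul_assoc _ (1 - X * Y), h1,
          Matrix.mul_zero, add_zero]
      rw [Matrix.mul_add, Matrix.mul_one, Matrix.mul_smul, h3]
      simp only [N]
      rw [Matrix.mul_sub, h2, Matrix.mul_one, hz, sub_smul (z - z₀), one_smul]
      abel
    rw [hfac, Matrix.det_mul, hdet, smul_eq_mul, mul_comm]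

/-! ### Diagonalisation of the S-matrix -/

namespace BoundaryCondition

variable {E : Type*} [Fintype E] [DecidableEq E] (bc : BoundaryCondition E)

lemma linB_L (x : bc.ranBstar) : bc.linB (bc.L x) = bc.linA x := by
  have h := LinearEquiv.apply_symm_apply (LinearEquiv.ofBijective bc.restrictB bc.restrictB_bijective)
    ((bc.linA ∘ₗ bc.ranBstar.subtype).codRestrict (LinearMap.range bc.linB) bc.linA_mem_range x)
  exact congrArg Subtype.val h

/-- Elements of `ran B*` have the form `x = B* v`, `y = B* w`. Then `⟨L x, y⟩ = ⟨B L x, w⟩ = ⟨A B*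
v, w⟩`, and `A B*` is self-adjoint. -/
lemma isSymmetric_L : bc.L.IsSymmetric := by
  have hran : ∀ x : bc.ranBstar, ∃ w, LinearMap.adjoint bc.linB w = x := by
    intro x
    exact LinearMap.mem_range.1 (LinearMap.orthogonal_ker bc.linB ▸ x.2)
  have hAB : ∀ v, bc.linA (LinearMap.adjoint bc.linB v) = bc.linB (LinearMap.adjoint bc.linA v) := by
    intro v
    have hH : bc.A * bc.B.conjTranspose = bc.B * bc.A.conjTranspose := by
      have := bc.isHermitian.eq
      rw [Matrix.conjTranspose_mul, Matrix.conjTranspose_conjTranspose] at this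
      exact this.symm
    simp only [linA, linB, ← Matrix.toEuclideanLin_conjTranspose_eq_adjoint,
      Matrix.toLpLin_apply, Matrix.mulVec_mulVec, hH]
  intro x y
  obtain ⟨v, hv⟩ := hran x
  obtain ⟨w, hw⟩ := hran y
  rw [Submodule.coe_inner, Submodule.coe_inner, ← hw, LinearMap.adjoint_inner_right, linB_L, ← hv,
    LinearMap.adjoint_inner_left, linB_L, ← hw, hAB, ← LinearMap.adjoint_inner_right,
    LinearMap.adjoint_inner_left]

/-- An orthonormal basis adapted to the boundary conditions: every vector of it is either an
eigenvector of `L` or an element of `ker B`. -/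
lemma exists_eigenbasis : ∃ (b : OrthonormalBasis (E ⊕ E) ℂ (EuclideanSpace ℂ (E ⊕ E)))
    (μ : E ⊕ E → ℝ), ∀ i,
      (bc.linA (b i) = (μ i : ℂ) • bc.linB (b i) ∧ bc.L.HasEigenvalue (μ i : ℂ)) ∨
      (bc.linB (b i) = 0 ∧ μ i = 0) := by
  -- `L` is extended by the scalar `c` on `ker B`. With `c` outside the spectrum of `L`, no
  -- eigenvector of the extension `G` can mix `ran B*` and `ker B`.
  obtain ⟨c, hc⟩ : ∃ c : ℝ, ¬ bc.L.HasEigenvalue (c : ℂ) := by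
    have hfin : {μ : ℂ | bc.L.HasEigenvalue μ}.Finite := bc.L.finite_hasEigenvalue
    have := (hfin.preimage Complex.ofReal_injective.injOn).infinite_compl
    exact this.nonempty
  let ι := bc.ranBstar.subtype
  let Q := LinearMap.adjoint ι
  have hQι : ∀ x, Q (ι x) = x := by
    intro x
    refine ext_inner_left ℂ fun v => ?_
    rw [LinearMap.adjoint_inner_right]; rfl
  let G : EuclideanSpace ℂ (E ⊕ E) →ₗ[ℂ] EuclideanSpace ℂ (E ⊕ E) :=
    ι ∘ₗ bc.L ∘ₗ Q + (c : ℂ) • (LinearMap.id - ι ∘ₗ Q)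
  have hG : G.IsSymmetric := by
    intro x y
    simp only [G, LinearMap.add_apply, LinearMap.comp_apply, LinearMap.smul_apply,
      LinearMap.sub_apply, LinearMap.id_apply, inner_add_left, inner_add_right, inner_smul_left,
      inner_smul_right, inner_sub_left, inner_sub_right, Complex.conj_ofReal]
    rw [← LinearMap.adjoint_inner_right, ← LinearMap.adjoint_inner_right ι (Q x) y,
      ← LinearMap.adjoint_inner_left ι, ← LinearMap.adjoint_inner_left ι (Q y) x]
    rw [bc.isSymmetric_L]
  have hn : Module.finrank ℂ (EuclideanSpace ℂ (E ⊕ E)) = Fintype.card (E ⊕ E) :=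
    finrank_euclideanSpace
  let e := (Fintype.equivFin (E ⊕ E)).symm
  suffices key : ∀ i, ∃ m : ℝ,
      (bc.linA ((hG.eigenvectorBasis hn).reindex e i)
          = (m : ℂ) • bc.linB ((hG.eigenvectorBasis hn).reindex e i) ∧
        bc.L.HasEigenvalue (m : ℂ)) ∨
      (bc.linB ((hG.eigenvectorBasis hn).reindex e i) = 0 ∧ m = 0) by
    choose μ hμ using key
    exact ⟨(hG.eigenvectorBasis hn).reindex e, μ, hμ⟩
  intro i
  rw [OrthonormalBasis.reindex_apply]
  set j := e.symm i
  set v := hG.eigenvectorBasis hn j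
  set m := hG.eigenvalues hn j
  have hv0 : v ≠ 0 := (hG.eigenvectorBasis hn).toBasis.ne_zero j
  have hv : G v = (m : ℂ) • v := hG.apply_eigenvectorBasis hn j
  have hQv : bc.L (Q v) = (m : ℂ) • Q v := by
    have := congrArg Q hv
    simpa only [G, LinearMap.add_apply, LinearMap.comp_apply, LinearMap.smul_apply,
      LinearMap.sub_apply, LinearMap.id_apply, map_add, map_smul, map_sub, hQι, sub_self,
      smul_zero, add_zero] using this
  by_cases hz : Q v = 0
  · refine ⟨0, Or.inr ⟨?_, rfl⟩⟩
    have : v ∈ bc.ranBstarᗮ := by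
      rw [Submodule.mem_orthogonal]
      intro u hu
      have : inner ℂ (ι ⟨u, hu⟩) v = 0 := by
        rw [← LinearMap.adjoint_inner_right]
        change inner ℂ _ (Q v) = 0
        rw [hz, inner_zero_right]
      exact this
    rw [Submodule.orthogonal_orthogonal] at this
    exact this
  · have hev : bc.L.HasEigenvalue (m : ℂ) :=
      Module.End.hasEigenvalue_of_hasEigenvector ⟨Module.End.mem_eigenspace_iff.2 hQv, hz⟩
    refine ⟨m, Or.inl ⟨?_, hev⟩⟩
    have hmc : (m : ℂ) - c ≠ 0 := by
      intro h
      rw [sub_eq_zero.1 h] at hev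
      exact hc hev
    -- The component of `v` in `ker B` is multiplied by `c` under `G`, but also by `m ≠ c`, so it
    -- vanishes.
    have hι : ι (Q v) = v := by
      have h1 : ((m : ℂ) - c) • (ι (Q v) - v) = 0 := by
        have h2 : (m : ℂ) • ι (Q v) + (c : ℂ) • (v - ι (Q v)) = (m : ℂ) • v := by
          rw [← hv]
          simp only [G, LinearMap.add_apply, LinearMap.comp_apply, LinearMap.smul_apply,
            LinearMap.sub_apply, LinearMap.id_apply, hQv, map_smul]
        rw [sub_smul, smul_sub, smul_sub, ← h2, smul_sub]
        abel
      exact sub_eq_zero.1 ((smul_eq_zero.1 h1).resolve_left hmc)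
    have h3 := bc.linB_L (Q v)
    rw [hQv] at h3
    change bc.linB (ι ((m : ℂ) • Q v)) = bc.linA (ι (Q v)) at h3
    rw [map_smul, hι, map_smul] at h3
    exact h3.symm

/-- The matrix form of `exists_eigenbasis`: `W` is unitary and every column `w` of it satisfies
`A w = μ B w` for an eigenvalue `μ` of `L`, or `B w = 0`. -/
lemma exists_unitary : ∃ (W : Matrix (E ⊕ E) (E ⊕ E) ℂ) (μ : E ⊕ E → ℝ),
    W.conjTranspose * W = 1 ∧ W * W.conjTranspose = 1 ∧ ∀ i,
      (bc.A.mulVec (W.col i) = (μ i : ℂ) • bc.B.mulVec (W.col i) ∧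
        bc.L.HasEigenvalue (μ i : ℂ)) ∨
      (bc.B.mulVec (W.col i) = 0 ∧ μ i = 0) := by
  obtain ⟨b, μ, hb⟩ := bc.exists_eigenbasis
  let W : Matrix (E ⊕ E) (E ⊕ E) ℂ := (EuclideanSpace.basisFun (E ⊕ E) ℂ).toBasis.toMatrix b
  have hW : W ∈ Matrix.unitaryGroup (E ⊕ E) ℂ :=
    (EuclideanSpace.basisFun (E ⊕ E) ℂ).toMatrix_orthonormalBasis_mem_unitary b
  have hcol : ∀ i, W.col i = (b i).ofLp := fun i => rfl
  refine ⟨W, μ, Matrix.mem_unitaryGroup_iff'.1 hW, Matrix.mem_unitaryGroup_iff.1 hW, fun i => ?_⟩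
  rw [hcol]
  exact (hb i).imp (fun h => ⟨congrArg WithLp.ofLp h.1, h.2⟩)
    (fun h => ⟨congrArg WithLp.ofLp h.1, h.2⟩)

end BoundaryCondition
/-! ### The S-matrix in the eigenbasis of `L` -/

/-- The quotient `(μ - iz) / (μ + iz)`. -/
noncomputable def reflectionCoeff (μ : ℝ) (z : ℂ) : ℂ :=
  (μ - Complex.I * z) / (μ + Complex.I * z)

/-- The imaginary part of `μ + iz` is `Re z`: all poles of the reflection coefficients lie on the
imaginary axis. -/
lemma add_I_mul_ne_zero (μ : ℝ) {z : ℂ} (hz : z.re ≠ 0) : (μ : ℂ) + Complex.I * z ≠ 0 := by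
  intro h
  exact hz (by simpa using congrArg Complex.im h)

lemma hasDerivAt_reflectionCoeff (μ : ℝ) {z : ℂ} (hz : z.re ≠ 0) :
    HasDerivAt (reflectionCoeff μ)
      (-2 * Complex.I * μ / (μ + Complex.I * z) ^ 2) z := by
  have h0 : HasDerivAt (fun w : ℂ => Complex.I * w) Complex.I z := by
    simpa using (hasDerivAt_id z).const_mul Complex.I
  have := (h0.const_sub (μ : ℂ)).div (h0.const_add (μ : ℂ)) (add_I_mul_ne_zero μ hz)
  refine this.congr_deriv ?_
  congr 1
  ring

lemma analyticAt_reflectionCoeff (μ : ℝ) {z : ℂ} (hz : z.re ≠ 0) :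
    AnalyticAt ℂ (reflectionCoeff μ) z := by
  have h0 : AnalyticAt ℂ (fun w : ℂ => Complex.I * w) z := analyticAt_const.mul analyticAt_id
  exact (analyticAt_const.sub h0).div (analyticAt_const.add h0) (add_I_mul_ne_zero μ hz)

lemma reflectionCoeff_mul_conj (μ : ℝ) {k : ℝ} (hk : k ≠ 0) :
    reflectionCoeff μ k * star (reflectionCoeff μ k) = 1 := by
  have h1 : (μ : ℂ) + Complex.I * k ≠ 0 := add_I_mul_ne_zero μ (by simpa using hk)
  have h2 : (μ : ℂ) - Complex.I * k ≠ 0 := by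
    simpa [sub_eq_add_neg] using add_I_mul_ne_zero μ (z := -(k : ℂ)) (by simpa using hk)
  simp only [reflectionCoeff, star_div₀, star_add, star_sub, star_mul', RCLike.star_def,
    Complex.conj_I, Complex.conj_ofReal]
  rw [neg_mul, sub_neg_eq_add, ← sub_eq_add_neg]
  field_simp

/-- On the real axis the coefficient is unimodular, so this product is `i` times the derivative of
its phase. The phase decreases at rate `2μ/(μ² + k²)`, which for `μ > 0` competes with the growing
phases `k l` of `T`. -/
lemma deriv_reflectionCoeff_mul_conj (μ : ℝ) {k : ℝ} (hk : k ≠ 0) :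
    deriv (reflectionCoeff μ) k * star (reflectionCoeff μ k)
      = -(Complex.I * ((2 * μ / (μ ^ 2 + k ^ 2) : ℝ) : ℂ)) := by
  have h1 : (μ : ℂ) + Complex.I * k ≠ 0 := add_I_mul_ne_zero μ (by simpa using hk)
  have h2 : (μ : ℂ) - Complex.I * k ≠ 0 := by
    simpa [sub_eq_add_neg] using add_I_mul_ne_zero μ (z := -(k : ℂ)) (by simpa using hk)
  have h3 : ((μ : ℂ) ^ 2 + k ^ 2) = (μ + Complex.I * k) * (μ - Complex.I * k) := by
    ring_nf; rw [Complex.I_sq]; ring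
  rw [(hasDerivAt_reflectionCoeff μ (by simpa using hk)).deriv]
  simp only [reflectionCoeff, star_div₀, star_add, star_sub, star_mul', RCLike.star_def,
    Complex.conj_I, Complex.conj_ofReal]
  rw [neg_mul Complex.I, sub_neg_eq_add, ← sub_eq_add_neg]
  push_cast
  rw [h3]
  field_simp

namespace BoundaryCondition

variable {E : Type*} [Fintype E] [DecidableEq E] (bc : BoundaryCondition E)

/-- With `C = A + izB`, a basis vector `w` in `ran B*` satisfies `C w = (μ + iz) B w` with a nonzero
factor, so `ran C` contains `ran B`. It then contains the range of `A = C - izB` too, and the rank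
condition makes `C` surjective. -/
lemma isUnit_A_add_B {z : ℂ} (hz : z.re ≠ 0) : IsUnit (bc.A + (Complex.I * z) • bc.B) := by
  obtain ⟨W, μ, -, hW, hcol⟩ := bc.exists_unitary
  rw [← Matrix.mulVec_surjective_iff_isUnit]
  set C := bc.A + (Complex.I * z) • bc.B
  have hBcol : ∀ i, bc.B.mulVec (W.col i) ∈ LinearMap.range C.mulVecLin := by
    intro i
    rcases hcol i with ⟨h, -⟩ | ⟨h, -⟩
    · have h1 : C.mulVec (W.col i) = ((μ i : ℂ) + Complex.I * z) • bc.B.mulVec (W.col i) := by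
        rw [Matrix.add_mulVec, Matrix.smul_mulVec, h, add_smul]
      refine ⟨((μ i : ℂ) + Complex.I * z)⁻¹ • W.col i, ?_⟩
      rw [map_smul, Matrix.mulVecLin_apply, h1, smul_smul,
        inv_mul_cancel₀ (add_I_mul_ne_zero _ hz), one_smul]
    · rw [h]; exact Submodule.zero_mem _
  have hB : ∀ v, bc.B.mulVec v ∈ LinearMap.range C.mulVecLin := by
    intro v
    have h1 : bc.B.mulVec v = ∑ i, (W.conjTranspose.mulVec v) i • bc.B.mulVec (W.col i) := by
      conv_lhs => rw [← Matrix.one_mulVec v, ← hW, ← Matrix.mulVec_mulVec]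
      generalize W.conjTranspose.mulVec v = c
      rw [Matrix.mulVec_mulVec]
      ext a
      simp only [Matrix.mulVec, dotProduct, Finset.sum_apply, Pi.smul_apply, smul_eq_mul]
      exact Finset.sum_congr rfl fun i _ => mul_comm _ _
    rw [h1]
    exact Submodule.sum_mem _ fun i _ => Submodule.smul_mem _ _ (hBcol i)
  have hA : ∀ v, bc.A.mulVec v ∈ LinearMap.range C.mulVecLin := by
    intro v
    have h1 : bc.A.mulVec v = C.mulVec v - (Complex.I * z) • bc.B.mulVec v := by
      rw [Matrix.add_mulVec, Matrix.smul_mulVec, add_sub_cancel_right]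
    rw [h1]
    exact Submodule.sub_mem _ ⟨v, rfl⟩ (Submodule.smul_mem _ _ (hB v))
  intro y
  have htop : LinearMap.range (Matrix.fromCols bc.A bc.B).mulVecLin = ⊤ := by
    refine Submodule.eq_top_of_finrank_eq ?_
    rw [Module.finrank_fintype_fun_eq_card]
    exact bc.rank_eq
  obtain ⟨x, hx⟩ : y ∈ LinearMap.range (Matrix.fromCols bc.A bc.B).mulVecLin :=
    htop ▸ Submodule.mem_top
  rw [Matrix.mulVecLin_apply, Matrix.fromCols_mulVec] at hx
  have : y ∈ LinearMap.range C.mulVecLin := hx ▸ Submodule.add_mem _ (hA _) (hB _)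
  exact this

/-- In an orthonormal basis independent of `z`, the matrix `S z` is diagonal. -/
lemma exists_S_eq : ∃ (W : Matrix (E ⊕ E) (E ⊕ E) ℂ) (s : E ⊕ E → ℂ → ℂ),
    W.conjTranspose * W = 1 ∧ W * W.conjTranspose = 1 ∧
    (∀ z : ℂ, z.re ≠ 0 → bc.S z = -(W * Matrix.diagonal (fun i => s i z) * W.conjTranspose)) ∧
    ∀ i, s i = (fun _ => 1) ∨
      ∃ μ : ℝ, bc.L.HasEigenvalue (μ : ℂ) ∧ s i = reflectionCoeff μ := by
  classical
  obtain ⟨W, μ, hW1, hW2, hcol⟩ := bc.exists_unitary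
  refine ⟨W, fun i => if bc.B.mulVec (W.col i) = 0 then fun _ => 1 else reflectionCoeff (μ i),
    hW1, hW2, fun z hz => ?_, fun i => ?_⟩
  · have hkey : (bc.A - (Complex.I * z) • bc.B) * W = (bc.A + (Complex.I * z) • bc.B) *
        (W * Matrix.diagonal fun i => (if bc.B.mulVec (W.col i) = 0 then fun _ => 1
          else reflectionCoeff (μ i) : ℂ → ℂ) z) := by
      rw [← Matrix.mul_assoc]
      ext a i
      rw [Matrix.mul_diagonal]
      have hvec : (bc.A - (Complex.I * z) • bc.B).mulVec (W.col i) =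
          ((if bc.B.mulVec (W.col i) = 0 then fun _ => 1 else reflectionCoeff (μ i) : ℂ → ℂ) z) •
            (bc.A + (Complex.I * z) • bc.B).mulVec (W.col i) := by
        rw [Matrix.add_mulVec, Matrix.sub_mulVec, Matrix.smul_mulVec]
        split_ifs with h
        · simp [h]
        · have h1 := ((hcol i).resolve_right fun h2 => h h2.1).1
          rw [h1, ← sub_smul, ← add_smul, smul_smul, reflectionCoeff,
            div_mul_cancel₀ _ (add_I_mul_ne_zero _ hz)]
      have := congrFun hvec a
      rw [Pi.smul_apply, smul_eq_mul] at this
      exact this.trans (mul_comm _ _)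
    have hu := (Matrix.isUnit_iff_isUnit_det _).1 (bc.isUnit_A_add_B hz)
    rw [S, ← Matrix.mul_one (bc.A - (Complex.I * z) • bc.B), ← hW2, ← Matrix.mul_assoc _ W, hkey,
      Matrix.mul_assoc _ (W * _), Matrix.nonsing_inv_mul_cancel_left _ _ hu]
  · by_cases h : bc.B.mulVec (W.col i) = 0
    · exact Or.inl (if_pos h)
    · exact Or.inr ⟨μ i, ((hcol i).resolve_right fun h2 => h h2.1).2, if_neg h⟩

end BoundaryCondition

/-! ### Non-degeneracy of the derivative -/

lemma star_dotProduct_diagonal_mulVec {n : Type*} [Fintype n] [DecidableEq n] (d : n → ℝ)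
    (p : n → ℂ) : star p ⬝ᵥ (Matrix.diagonal fun i => (d i : ℂ)).mulVec p
      = ((∑ i, d i * ‖p i‖ ^ 2 : ℝ) : ℂ) := by
  simp only [dotProduct, Matrix.mulVec_diagonal, Pi.star_apply, RCLike.star_def]
  push_cast
  refine Finset.sum_congr rfl fun i _ => ?_
  rw [← Complex.conj_mul']
  ring

/-- The vector on the left of `hu` is the derivative of `1 - U` applied to `p`. Pairing with `p`
kills the right side, because `U` is unitary and fixes `p`. What remains is `∑ κᵢ |cᵢ|² = ∑ dᵢ
|pᵢ|²` with `c = W* p` of the same norm as `p`, which the gap `κᵢ ≤ K < dᵢ` allows only for `p = 0`.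
-/
lemma eq_zero_of_derivative_mem_range {n : Type*} [Fintype n] [DecidableEq n]
    {W T : Matrix n n ℂ} {s s' : n → ℂ} {κ d : n → ℝ} {K : ℝ}
    (hW1 : W.conjTranspose * W = 1) (hW2 : W * W.conjTranspose = 1)
    (hT : T.conjTranspose * T = 1) (hs : ∀ i, s i * star (s i) = 1)
    (hs' : ∀ i, s' i * star (s i) = -(Complex.I * κ i)) (hκ : ∀ i, κ i ≤ K) (hd : ∀ i, K < d i)
    {U : Matrix n n ℂ} (hU : U = -(W * Matrix.diagonal s * W.conjTranspose) * T)
    {p u : n → ℂ} (hp : (1 - U).mulVec p = 0)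
    (hu : (W * Matrix.diagonal s' * W.conjTranspose * T
      - Complex.I • (U * Matrix.diagonal fun i => (d i : ℂ))).mulVec p = (1 - U).mulVec u) :
    p = 0 := by
  set c := W.conjTranspose.mulVec p with hc
  have hUp : U.mulVec p = p := by
    rw [Matrix.sub_mulVec, Matrix.one_mulVec, sub_eq_zero] at hp
    exact hp.symm
  have hss : Matrix.diagonal (star s) * Matrix.diagonal s = 1 := by
    rw [Matrix.diagonal_mul_diagonal, ← Matrix.diagonal_one]
    exact congrArg _ (funext fun i => by rw [Pi.star_apply, mul_comm]; exact hs i)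
  have hUU : U.conjTranspose * U = 1 := by
    rw [hU]
    simp only [Matrix.conjTranspose_mul, Matrix.conjTranspose_neg,
      Matrix.conjTranspose_conjTranspose, Matrix.diagonal_conjTranspose, Matrix.neg_mul,
      Matrix.mul_neg, neg_neg]
    calc T.conjTranspose * (W * (Matrix.diagonal (star s) * W.conjTranspose)) *
          (W * Matrix.diagonal s * W.conjTranspose * T)
        = T.conjTranspose * (W * (Matrix.diagonal (star s) * (W.conjTranspose * W) *
          Matrix.diagonal s) * W.conjTranspose) * T := by simp only [Matrix.mul_assoc]
      _ = 1 := by rw [hW1, Matrix.mul_one, hss, Matrix.mul_one, hW2, Matrix.mul_one, hT]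
  have hUsp : U.conjTranspose.mulVec p = p := by
    conv_lhs => rw [← hUp, Matrix.mulVec_mulVec, hUU, Matrix.one_mulVec]
  have hleft : ∀ v, star p ⬝ᵥ U.mulVec v = star p ⬝ᵥ v := by
    intro v
    rw [Matrix.dotProduct_mulVec, ← Matrix.conjTranspose_conjTranspose U, ← Matrix.star_mulVec,
      hUsp]
  have h0 := congrArg (fun v => star p ⬝ᵥ v) hu
  simp only [Matrix.sub_mulVec, dotProduct_sub, Matrix.one_mulVec, hleft, sub_self,
    Matrix.smul_mulVec, dotProduct_smul] at h0
  rw [← Matrix.mulVec_mulVec p U, hleft, star_dotProduct_diagonal_mulVec] at h0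
  -- `U p = p` is solved for `T p`, so that only the products `s' * star s` enter the quadratic
  -- form.
  have hWT : (W.conjTranspose * T).mulVec p = -(Matrix.diagonal (star s)).mulVec c := by
    rw [hc]
    nth_rewrite 2 [← hUp]
    rw [hU, Matrix.mulVec_mulVec, Matrix.mulVec_mulVec, ← Matrix.neg_mulVec]
    congr 1
    simp only [Matrix.neg_mul, Matrix.mul_neg, neg_neg]
    calc W.conjTranspose * T = Matrix.diagonal (star s) * Matrix.diagonal s *
          (W.conjTranspose * T) := by rw [hss, Matrix.one_mul]
      _ = Matrix.diagonal (star s) * (W.conjTranspose * W) * Matrix.diagonal s *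
          (W.conjTranspose * T) := by rw [hW1, Matrix.mul_one]
      _ = _ := by simp only [Matrix.mul_assoc]
  have hfirst : star p ⬝ᵥ (W * Matrix.diagonal s' * W.conjTranspose * T).mulVec p
      = Complex.I * ((∑ i, κ i * ‖c i‖ ^ 2 : ℝ) : ℂ) := by
    rw [← star_dotProduct_diagonal_mulVec, Matrix.mul_assoc _ W.conjTranspose,
      ← Matrix.mulVec_mulVec, hWT, ← Matrix.mulVec_mulVec, Matrix.dotProduct_mulVec,
      ← Matrix.conjTranspose_conjTranspose W, ← Matrix.star_mulVec, ← hc, ← smul_eq_mul,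
      ← dotProduct_smul]
    congr 1
    ext i
    simp only [Matrix.mulVec_diagonal, Pi.neg_apply, Pi.smul_apply, Pi.star_apply, smul_eq_mul]
    have := hs' i
    linear_combination (-(c i)) * this
  have hnorm : ∑ i, ‖c i‖ ^ 2 = ∑ i, ‖p i‖ ^ 2 := by
    have h1 : star c ⬝ᵥ c = star p ⬝ᵥ p := by
      rw [hc, Matrix.star_mulVec, Matrix.conjTranspose_conjTranspose, ← Matrix.dotProduct_mulVec,
        Matrix.mulVec_mulVec, hW2, Matrix.one_mulVec]
    have h2 : ∀ v : n → ℂ, star v ⬝ᵥ v = ((∑ i, ‖v i‖ ^ 2 : ℝ) : ℂ) := by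
      intro v
      simpa using star_dotProduct_diagonal_mulVec (fun _ => (1 : ℝ)) v
    rw [h2, h2] at h1
    exact_mod_cast h1
  have hsum : ∑ i, κ i * ‖c i‖ ^ 2 = ∑ i, d i * ‖p i‖ ^ 2 := by
    rw [hfirst, smul_eq_mul, ← mul_sub, mul_eq_zero, sub_eq_zero] at h0
    exact_mod_cast h0.resolve_left Complex.I_ne_zero
  have hle : ∑ i, κ i * ‖c i‖ ^ 2 ≤ K * ∑ i, ‖p i‖ ^ 2 := by
    rw [← hnorm, Finset.mul_sum]
    exact Finset.sum_le_sum fun i _ => mul_le_mul_of_nonneg_right (hκ i) (sq_nonneg _)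
  have hnn : ∀ i ∈ Finset.univ, 0 ≤ (d i - K) * ‖p i‖ ^ 2 := fun i _ =>
    mul_nonneg (sub_nonneg.2 (hd i).le) (sq_nonneg _)
  have hz : ∑ i, (d i - K) * ‖p i‖ ^ 2 = 0 := by
    refine le_antisymm ?_ (Finset.sum_nonneg hnn)
    simp only [sub_mul, Finset.sum_sub_distrib, ← Finset.mul_sum]
    linarith
  ext i
  have := (Finset.sum_eq_zero_iff_of_nonneg hnn).1 hz i (Finset.mem_univ i)
  have h3 := (mul_eq_zero.1 this).resolve_left (sub_pos.2 (hd i)).ne'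
  simpa using h3

/-! ### The order of the zeros of the secular function -/

lemma analyticAt_mul_apply {m n : Type*} [Fintype n] {M : ℂ → Matrix m n ℂ}
    {N : ℂ → Matrix n m ℂ} {z₀ : ℂ} (hM : ∀ i j, AnalyticAt ℂ (fun z => M z i j) z₀)
    (hN : ∀ i j, AnalyticAt ℂ (fun z => N z i j) z₀) (i j : m) :
    AnalyticAt ℂ (fun z => (M z * N z) i j) z₀ := by
  simp only [Matrix.mul_apply]
  exact Finset.analyticAt_fun_sum _ fun l _ => (hM i l).mul (hN l j)

lemma analyticAt_diagonal_apply {n : Type*} [DecidableEq n] {s : n → ℂ → ℂ} {z₀ : ℂ}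
    (hs : ∀ i, AnalyticAt ℂ (s i) z₀) (i j : n) :
    AnalyticAt ℂ (fun z => Matrix.diagonal (fun i => s i z) i j) z₀ := by
  by_cases h : i = j
  · subst h; simpa only [Matrix.diagonal_apply_eq] using hs i
  · simpa only [Matrix.diagonal_apply_ne _ h] using analyticAt_const

lemma analyticAt_dslope {f : ℂ → ℂ} {z₀ : ℂ} (hf : AnalyticAt ℂ f z₀) :
    AnalyticAt ℂ (dslope f z₀) z₀ :=
  let ⟨_, hp⟩ := hf
  ⟨_, hp.has_fpower_series_dslope_fslope⟩

lemma eq_add_mul_dslope (f : ℂ → ℂ) (z₀ z : ℂ) : f z = f z₀ + (z - z₀) * dslope f z₀ z := by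
  rw [← smul_eq_mul, sub_smul_dslope]; ring

/-- An antidiagonal block matrix with equal diagonal blocks. -/
def swapDiagonal {E : Type*} [DecidableEq E] (d : E → ℂ) : Matrix (E ⊕ E) (E ⊕ E) ℂ :=
  Matrix.fromBlocks 0 (Matrix.diagonal d) (Matrix.diagonal d) 0

lemma analyticAt_swapDiagonal_apply {E : Type*} [DecidableEq E] {s : E → ℂ → ℂ} {z₀ : ℂ}
    (hs : ∀ i, AnalyticAt ℂ (s i) z₀) (i j : E ⊕ E) :
    AnalyticAt ℂ (fun z => swapDiagonal (fun i => s i z) i j) z₀ := by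
  rcases i with i | i <;> rcases j with j | j
  · exact analyticAt_const
  · exact analyticAt_diagonal_apply hs i j
  · exact analyticAt_diagonal_apply hs i j
  · exact analyticAt_const

lemma hasDerivAt_exp_I_mul (l : ℝ) (z : ℂ) :
    HasDerivAt (fun z : ℂ => Complex.exp (Complex.I * z * l))
      (Complex.I * l * Complex.exp (Complex.I * z * l)) z := by
  have h0 : HasDerivAt (fun w : ℂ => Complex.I * w * l) (Complex.I * l) z := by
    simpa using ((hasDerivAt_id z).const_mul Complex.I).mul_const (l : ℂ)
  exact h0.cexp.congr_deriv (mul_comm _ _)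

lemma star_exp_I_mul (k l : ℝ) :
    star (Complex.exp (Complex.I * k * l)) * Complex.exp (Complex.I * k * l) = 1 := by
  rw [RCLike.star_def, ← Complex.exp_conj, ← Complex.exp_add]
  simp

lemma MetricGraph.T_eq {V E : Type*} [DecidableEq E] (Γ : MetricGraph V E)
    (z : ℂ) : Γ.T z = swapDiagonal fun e => Complex.exp (Complex.I * z * Γ.length e) := rfl

variable {V E : Type*} [Fintype E] [DecidableEq E]

lemma MetricGraph.conjTranspose_T_mul_T (Γ : MetricGraph V E) (k : ℝ) :
    (Γ.T k).conjTranspose * Γ.T k = 1 := by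
  have h : (fun e => star (Complex.exp (Complex.I * k * Γ.length e)) *
      Complex.exp (Complex.I * k * Γ.length e)) = fun _ : E => (1 : ℂ) :=
    funext fun e => star_exp_I_mul k _
  rw [Γ.T_eq, swapDiagonal, Matrix.fromBlocks_conjTranspose, Matrix.fromBlocks_multiply]
  simp only [Matrix.diagonal_conjTranspose, Matrix.diagonal_mul_diagonal, Matrix.conjTranspose_zero,
    Matrix.zero_mul, Matrix.mul_zero, zero_add, add_zero, Pi.star_apply, h]
  rw [Matrix.diagonal_one, Matrix.fromBlocks_one]

/-- `K = 2/λ⁺_min` works: nonpositive `μ` contribute nothing positive, and for `μ > 0` one has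
`2μ/(μ² + k²) ≤ 2/μ ≤ K`. If `L` has no positive eigenvalue then `K = 0`, and the lengths still
exceed it. -/
lemma deriv_phase_le {bc : BoundaryCondition E} {Γ : MetricGraph V E}
    (hl : 2 / bc.lambdaPlusMin < Γ.lMin) :
    ∃ K : ℝ, 0 ≤ K ∧ (∀ e, K < Γ.length e) ∧
      ∀ (μ k : ℝ), bc.L.HasEigenvalue (μ : ℂ) → k ≠ 0 → 2 * μ / (μ ^ 2 + k ^ 2) ≤ K := by
  have htop : 2 / bc.lambdaPlusMin ≠ ⊤ := hl.ne_top
  refine ⟨(2 / bc.lambdaPlusMin).toReal, ENNReal.toReal_nonneg, fun e => ?_, fun μ k hμ hk => ?_⟩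
  · have h1 := hl.trans_le (iInf_le _ e)
    rw [← ENNReal.ofReal_toReal htop] at h1
    exact (ENNReal.ofReal_lt_ofReal_iff (Γ.length_pos e)).1 h1
  · have hk2 : 0 < k ^ 2 := by positivity
    rcases le_or_gt μ 0 with h0 | h0
    · refine le_trans ?_ ENNReal.toReal_nonneg
      exact div_nonpos_of_nonpos_of_nonneg (by linarith) (by positivity)
    · have h1 : bc.lambdaPlusMin ≤ ENNReal.ofReal μ := iInf₂_le μ ⟨h0, hμ⟩
      have h2 : 2 / ENNReal.ofReal μ ≤ 2 / bc.lambdaPlusMin := ENNReal.div_le_div_left h1 2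
      have h3 := ENNReal.toReal_mono htop h2
      rw [ENNReal.toReal_div, ENNReal.toReal_ofReal h0.le, ENNReal.toReal_ofNat] at h3
      refine le_trans ?_ h3
      rw [div_le_div_iff₀ (by positivity) h0]
      nlinarith

/-- For small eigenvalues of `L` or long edges the order of a real zero `k ≠ 0` of the secular
function is the dimension of the fixed space of `U k`. -/
lemma analyticOrderAt_secularF (Γ : MetricGraph V E) (bc : BoundaryCondition E)
    (hl : 2 / bc.lambdaPlusMin < Γ.lMin) {k : ℝ} (hk : k ≠ 0) :
    AnalyticAt ℂ (secularF Γ bc) k ∧ analyticOrderAt (secularF Γ bc) k =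
      Module.finrank ℂ (LinearMap.ker (1 - U Γ bc k).mulVecLin) := by
  obtain ⟨W, s, hW1, hW2, hS, hs⟩ := bc.exists_S_eq
  obtain ⟨K, hK0, hKl, hKμ⟩ := deriv_phase_le hl
  have hkre : (k : ℂ).re ≠ 0 := by simpa using hk
  have hsan : ∀ i, AnalyticAt ℂ (s i) k := by
    intro i
    rcases hs i with h | ⟨μ, -, h⟩ <;> rw [h]
    · exact analyticAt_const
    · exact analyticAt_reflectionCoeff μ hkre
  have hss : ∀ i, s i k * star (s i k) = 1 := by
    intro i
    rcases hs i with h | ⟨μ, -, h⟩ <;> rw [h]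
    · simp
    · exact reflectionCoeff_mul_conj μ hk
  have hs' : ∀ i, ∃ κ : ℝ, κ ≤ K ∧ deriv (s i) k * star (s i k) = -(Complex.I * κ) := by
    intro i
    rcases hs i with h | ⟨μ, hμ, h⟩ <;> rw [h]
    · exact ⟨0, hK0, by simp⟩
    · exact ⟨_, hKμ μ k hμ hk, deriv_reflectionCoeff_mul_conj μ hk⟩
  choose κ hκK hκ using hs'
  let τ : E → ℂ → ℂ := fun e z => Complex.exp (Complex.I * z * Γ.length e)
  have hτan : ∀ e, AnalyticAt ℂ (τ e) k := fun e =>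
    ((analyticAt_const.mul analyticAt_id).mul analyticAt_const).cexp
  -- The difference quotient of `1 - U` by a discrete Leibniz rule: `S` varies against `T z`, then
  -- `T` varies against the fixed `S k`.
  let R : ℂ → Matrix (E ⊕ E) (E ⊕ E) ℂ := fun z =>
    W * Matrix.diagonal (fun i => dslope (s i) k z) * W.conjTranspose * Γ.T z
      - bc.S k * swapDiagonal (fun e => dslope (τ e) k z)
  refine analyticOrderAt_det (M := fun z => 1 - U Γ bc z) (R := R) (fun i j => ?_) ?_ ?_
  · simp only [R, Matrix.sub_apply]
    have hc : ∀ (C : Matrix (E ⊕ E) (E ⊕ E) ℂ) (i j : E ⊕ E),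
        AnalyticAt ℂ (fun _ : ℂ => C i j) k := fun _ _ _ => analyticAt_const
    have hdiag := analyticAt_diagonal_apply fun i => analyticAt_dslope (hsan i)
    have hτ' := analyticAt_swapDiagonal_apply fun e => analyticAt_dslope (hτan e)
    have hT : ∀ i j, AnalyticAt ℂ (fun z => Γ.T z i j) k := analyticAt_swapDiagonal_apply hτan
    have h1 := analyticAt_mul_apply (M := fun _ => W) (hc W) hdiag
    have h2 := analyticAt_mul_apply (N := fun _ => W.conjTranspose) h1 (hc _)
    exact (analyticAt_mul_apply (N := Γ.T) h2 hT i j).sub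
      (analyticAt_mul_apply (M := fun _ => bc.S k) (hc _) hτ' i j)
  · have hev : ∀ᶠ z : ℂ in nhds (k : ℂ), z.re ≠ 0 :=
      Complex.continuous_re.continuousAt.eventually_ne hkre
    filter_upwards [hev] with z hz
    have hSz : bc.S z = bc.S k - (z - k) •
        (W * Matrix.diagonal (fun i => dslope (s i) k z) * W.conjTranspose) := by
      have hd : Matrix.diagonal (fun i => s i z) = Matrix.diagonal (fun i => s i k)
          + (z - k) • Matrix.diagonal (fun i => dslope (s i) k z) := by
        rw [← Matrix.diagonal_smul, Matrix.diagonal_add]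
        exact congrArg _ (funext fun i => eq_add_mul_dslope (s i) k z)
      rw [hS z hz, hS k hkre, hd, Matrix.mul_add, Matrix.add_mul, Matrix.mul_smul,
        Matrix.smul_mul, neg_add, ← sub_eq_add_neg]
    have hTz : Γ.T z = Γ.T k + (z - k) • swapDiagonal (fun e => dslope (τ e) k z) := by
      have hd : Matrix.diagonal (fun i => τ i z) = Matrix.diagonal (fun i => τ i k)
          + (z - k) • Matrix.diagonal (fun i => dslope (τ i) k z) := by
        rw [← Matrix.diagonal_smul, Matrix.diagonal_add]
        exact congrArg _ (funext fun i => eq_add_mul_dslope (τ i) k z)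
      change Matrix.fromBlocks 0 (Matrix.diagonal fun i => τ i z)
        (Matrix.diagonal fun i => τ i z) 0 = Matrix.fromBlocks 0 (Matrix.diagonal fun i => τ i k)
        (Matrix.diagonal fun i => τ i k) 0 + _
      rw [swapDiagonal, Matrix.fromBlocks_smul, Matrix.fromBlocks_add, ← hd]
      simp
    have h1 : U Γ bc z = bc.S k * Γ.T z - (z - k) •
        (W * Matrix.diagonal (fun i => dslope (s i) k z) * W.conjTranspose * Γ.T z) := by
      rw [U, hSz, Matrix.sub_mul, Matrix.smul_mul]
    have h2 : bc.S k * Γ.T z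
        = U Γ bc k + (z - k) • (bc.S k * swapDiagonal (fun e => dslope (τ e) k z)) := by
      rw [hTz, Matrix.mul_add, Matrix.mul_smul, U]
    simp only [R]
    rw [h1, h2, smul_sub (z - (k : ℂ))]
    abel
  · intro p u hp hu
    refine eq_zero_of_derivative_mem_range (W := W) (T := Γ.T k) (s := fun i => s i k)
      (s' := fun i => deriv (s i) k) (κ := κ) (d := Sum.elim Γ.length Γ.length) (K := K) hW1 hW2
      (Γ.conjTranspose_T_mul_T k) hss hκ hκK (by rintro (e | e) <;> exact hKl e) (U := U Γ bc k)
      (by rw [U, hS k hkre]) hp (u := u) ?_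
    rw [← hu]
    congr 1
    simp only [R, dslope_same]
    congr 1
    rw [U, Matrix.mul_assoc, ← Matrix.mul_smul]
    congr 1
    -- At `z = k` the quotient of `T` is `T' = i T D` with `D` the diagonal matrix of lengths, hence
    -- `S T' = i U D`.
    have hdτ : (fun e => deriv (τ e) k)
        = fun e => Complex.I * (Complex.exp (Complex.I * k * Γ.length e) * Γ.length e) := by
      funext e
      rw [(hasDerivAt_exp_I_mul (Γ.length e) k).deriv]
      ring
    have hD : (Matrix.diagonal fun i => ((Sum.elim Γ.length Γ.length i : ℝ) : ℂ)) =
        Matrix.fromBlocks (Matrix.diagonal fun e => (Γ.length e : ℂ)) 0 0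
          (Matrix.diagonal fun e => (Γ.length e : ℂ)) := by
      rw [Matrix.fromBlocks_diagonal]
      refine congrArg _ (funext fun i => ?_)
      rcases i with e | e <;> rfl
    rw [hD, Γ.T_eq, hdτ, swapDiagonal, swapDiagonal, Matrix.fromBlocks_multiply,
      Matrix.fromBlocks_smul]
    simp only [Matrix.zero_mul, Matrix.mul_zero, add_zero, zero_add, Matrix.diagonal_mul_diagonal,
      smul_zero, ← Matrix.diagonal_smul]
    rfl

end QuantumGraph

namespace QuantumGraph

/-! ### Eigenfunctions as superpositions of plane waves -/

lemma IsSobolevTwo.continuousOn {l : ℝ} (hl : 0 < l) {f f₁ : ℝ → ℂ}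
    {f₂ : Lp ℂ 2 (volume.restrict (Ioo 0 l))} (h : IsSobolevTwo l f f₁ f₂) :
    ContinuousOn f (Icc 0 l) := by
  have := intervalIntegral.continuousOn_primitive_interval'
    (h.intervalIntegrable hl (right_mem_Icc.2 hl.le)) left_mem_uIcc
  rw [uIcc_of_le hl.le] at this
  exact (continuousOn_const.add this).congr h.eq_integral

/-- The equation `f'' = c² f` factors: `h = f' + c f` satisfies `h' = c h`, so `exp (-c x) h` is
constant. Using both `c` and `-c` recovers `f` and `f'`. -/
lemma IsSobolevTwo.add_mul_eq_exp {l : ℝ} (hl : 0 < l) {f f₁ : ℝ → ℂ}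
    {f₂ : Lp ℂ 2 (volume.restrict (Ioo 0 l))} (h : IsSobolevTwo l f f₁ f₂) {c : ℂ}
    (hc : f₂ =ᵐ[volume.restrict (Ioo 0 l)] fun x => c ^ 2 * f x) :
    ∀ x ∈ Icc 0 l, f₁ x + c * f x = Complex.exp (c * x) * (f₁ 0 + c * f 0) := by
  have h0 : (0 : ℝ) ∈ Icc 0 l := left_mem_Icc.2 hl.le
  -- Continuous extensions to the whole line turn the integral identities into genuine derivatives
  -- at every point, endpoints included.
  let g : ℝ → ℂ := IccExtend hl.le (domRestrict (Icc 0 l) f)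
  let g₁ : ℝ → ℂ := IccExtend hl.le (domRestrict (Icc 0 l) f₁)
  have hg : ∀ x ∈ Icc 0 l, g x = f x := fun x hx => IccExtend_of_mem hl.le _ hx
  have hg₁ : ∀ x ∈ Icc 0 l, g₁ x = f₁ x := fun x hx => IccExtend_of_mem hl.le _ hx
  have hgc : Continuous g :=
    (continuousOn_iff_continuous_domRestrict.1 (h.continuousOn hl)).Icc_extend'
  have hg₁c : Continuous g₁ :=
    (continuousOn_iff_continuous_domRestrict.1 (h.continuousOn_deriv hl)).Icc_extend'
  let G : ℝ → ℂ := fun x => f 0 + ∫ t in (0 : ℝ)..x, g₁ t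
  let G₁ : ℝ → ℂ := fun x => f₁ 0 + ∫ t in (0 : ℝ)..x, c ^ 2 * g t
  have hG : ∀ x ∈ Icc 0 l, G x = f x := by
    intro x hx
    rw [h.eq_integral x hx]
    refine congrArg (f 0 + ·) (intervalIntegral.integral_congr fun t ht => ?_)
    rw [uIcc_of_le hx.1] at ht
    exact hg₁ t ⟨ht.1, ht.2.trans hx.2⟩
  have hG₁ : ∀ x ∈ Icc 0 l, G₁ x = f₁ x := by
    intro x hx
    rw [h.deriv_eq_integral x hx, integral_congr_Ioo hc hx]
    refine congrArg (f₁ 0 + ·) (intervalIntegral.integral_congr fun t ht => ?_)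
    rw [uIcc_of_le hx.1] at ht
    exact congrArg (c ^ 2 * ·) (hg t ⟨ht.1, ht.2.trans hx.2⟩)
  have hGd : ∀ x, HasDerivAt G (g₁ x) x := fun x =>
    (hg₁c.integral_hasStrictDerivAt 0 x).hasDerivAt.const_add _
  have hG₁d : ∀ x, HasDerivAt G₁ (c ^ 2 * g x) x := fun x =>
    ((continuous_const.mul hgc).integral_hasStrictDerivAt 0 x).hasDerivAt.const_add _
  have hexp : ∀ x : ℝ, HasDerivAt (fun x : ℝ => Complex.exp (-(c * x)))
      (Complex.exp (-(c * x)) * -c) x := by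
    intro x
    have := (((hasDerivAt_id (x : ℂ)).const_mul c).neg.cexp).comp_ofReal
    simpa using this
  have hH : ∀ x : ℝ, HasDerivAt (fun x : ℝ => Complex.exp (-(c * x)) * (G₁ x + c * G x))
      (Complex.exp (-(c * x)) * -c * (G₁ x + c * G x)
        + Complex.exp (-(c * x)) * (c ^ 2 * g x + c * g₁ x)) x := fun x =>
    (hexp x).mul ((hG₁d x).add ((hGd x).const_mul c))
  intro x hx
  have hconst := constant_of_has_deriv_right_zero (a := 0) (b := l)
    (fun y _ => (hH y).continuousAt.continuousWithinAt) (fun y hy => by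
      have hy' : y ∈ Icc 0 l := Ico_subset_Icc_self hy
      have := (hH y).hasDerivWithinAt (s := Ici y)
      rw [hg y hy', hg₁ y hy', hG y hy', hG₁ y hy'] at this
      convert this using 1
      ring) x hx
  simp only [hG x hx, hG₁ x hx, hG 0 h0, hG₁ 0 h0, Complex.ofReal_zero, mul_zero, neg_zero,
    Complex.exp_zero, one_mul] at hconst
  rw [← hconst, ← mul_assoc, ← Complex.exp_add, add_neg_cancel, Complex.exp_zero, one_mul]

variable {V E : Type*}

/-- The function on the graph consisting of plane waves which leave the edge end `i` with
amplitude `a i`. -/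
noncomputable def MetricGraph.wave (Γ : MetricGraph V E) (k : ℝ) (a : E ⊕ E → ℂ) (e : E) (x : ℝ) :
    ℂ :=
  a (Sum.inl e) * Complex.exp (Complex.I * k * x)
    + a (Sum.inr e) * Complex.exp (Complex.I * k * (Γ.length e - x))

/-- The derivative of `MetricGraph.wave`. -/
noncomputable def MetricGraph.waveDeriv (Γ : MetricGraph V E) (k : ℝ) (a : E ⊕ E → ℂ) (e : E)
    (x : ℝ) : ℂ :=
  Complex.I * k * (a (Sum.inl e) * Complex.exp (Complex.I * k * x)
    - a (Sum.inr e) * Complex.exp (Complex.I * k * (Γ.length e - x)))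

section wave

variable (Γ : MetricGraph V E) (k : ℝ) (a : E ⊕ E → ℂ) (e : E)

lemma hasDerivAt_exp_right (c : ℂ) (x : ℝ) :
    HasDerivAt (fun x : ℝ => Complex.exp (c * x)) (c * Complex.exp (c * x)) x := by
  have := (((hasDerivAt_id (x : ℂ)).const_mul c).cexp).comp_ofReal
  simpa [mul_comm] using this

lemma hasDerivAt_exp_left (c : ℂ) (l x : ℝ) :
    HasDerivAt (fun x : ℝ => Complex.exp (c * (l - x))) (-(c * Complex.exp (c * (l - x)))) x := by
  have := ((((hasDerivAt_id (x : ℂ)).const_sub (l : ℂ)).const_mul c).cexp).comp_ofReal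
  simpa [mul_comm] using this

lemma hasDerivAt_wave (x : ℝ) : HasDerivAt (Γ.wave k a e) (Γ.waveDeriv k a e x) x := by
  refine (((hasDerivAt_exp_right (Complex.I * k) x).const_mul (a (Sum.inl e))).add
    ((hasDerivAt_exp_left (Complex.I * k) (Γ.length e) x).const_mul
      (a (Sum.inr e)))).congr_deriv ?_
  rw [MetricGraph.waveDeriv]; ring

lemma hasDerivAt_waveDeriv (x : ℝ) :
    HasDerivAt (Γ.waveDeriv k a e) (-(k : ℂ) ^ 2 * Γ.wave k a e x) x := by
  refine ((((hasDerivAt_exp_right (Complex.I * k) x).const_mul (a (Sum.inl e))).sub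
    ((hasDerivAt_exp_left (Complex.I * k) (Γ.length e) x).const_mul
      (a (Sum.inr e)))).const_mul (Complex.I * k)).congr_deriv ?_
  rw [MetricGraph.wave]
  linear_combination (k : ℂ) ^ 2 * (a (Sum.inl e) * Complex.exp (Complex.I * k * x)
    + a (Sum.inr e) * Complex.exp (Complex.I * k * (Γ.length e - x))) * Complex.I_sq

lemma continuous_wave : Continuous (Γ.wave k a e) :=
  continuous_iff_continuousAt.2 fun x => (hasDerivAt_wave Γ k a e x).continuousAt

lemma continuous_waveDeriv : Continuous (Γ.waveDeriv k a e) :=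
  continuous_iff_continuousAt.2 fun x => (hasDerivAt_waveDeriv Γ k a e x).continuousAt

lemma memLp_wave : MemLp (Γ.wave k a e) 2 (volume.restrict (Ioo 0 (Γ.length e))) := by
  obtain ⟨C, hC⟩ := (isCompact_Icc (a := (0 : ℝ)) (b := Γ.length e)).exists_bound_of_continuousOn
    (continuous_wave Γ k a e).continuousOn
  refine MemLp.of_bound (continuous_wave Γ k a e).aestronglyMeasurable C ?_
  exact (ae_restrict_iff' measurableSet_Ioo).2
    (Filter.Eventually.of_forall fun x hx => hC x (Ioo_subset_Icc_self hx))

end wave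

/-- The element of `L²(Γ)` given by `MetricGraph.wave`, as a linear function of the amplitudes. -/
noncomputable def MetricGraph.waveL2 (Γ : MetricGraph V E) (k : ℝ) : (E ⊕ E → ℂ) →ₗ[ℂ] Γ.L2 where
  toFun a := WithLp.toLp 2 fun e => (memLp_wave Γ k a e).toLp
  map_add' a b := PiLp.ext fun e => by
    refine Eq.trans (MemLp.toLp_congr (memLp_wave Γ k (a + b) e)
      ((memLp_wave Γ k a e).add (memLp_wave Γ k b e)) (Filter.Eventually.of_forall fun x => ?_))
      (MemLp.toLp_add (memLp_wave Γ k a e) (memLp_wave Γ k b e))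
    simp only [MetricGraph.wave, Pi.add_apply]
    ring
  map_smul' c a := PiLp.ext fun e => by
    refine Eq.trans (MemLp.toLp_congr (memLp_wave Γ k (c • a) e)
      ((memLp_wave Γ k a e).const_smul c) (Filter.Eventually.of_forall fun x => ?_))
      (MemLp.toLp_const_smul c (memLp_wave Γ k a e))
    simp only [MetricGraph.wave, Pi.smul_apply, smul_eq_mul]
    ring

lemma coeFn_waveL2 (Γ : MetricGraph V E) (k : ℝ) (a : E ⊕ E → ℂ) (e : E) :
    Γ.waveL2 k a e =ᵐ[volume.restrict (Ioo 0 (Γ.length e))] Γ.wave k a e :=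
  (memLp_wave Γ k a e).coeFn_toLp

lemma coeFn_neg_sq_smul (Γ : MetricGraph V E) (k : ℝ) (Φ : Γ.L2) (e : E) :
    (-((k : ℂ) ^ 2 • Φ)) e =ᵐ[volume.restrict (Ioo 0 (Γ.length e))]
      fun x => -(k : ℂ) ^ 2 * Φ e x := by
  have h1 : (-((k : ℂ) ^ 2 • Φ)) e = (-(k : ℂ) ^ 2) • Φ e := by
    simp only [PiLp.neg_apply, PiLp.smul_apply, neg_smul]
  rw [h1]
  exact Lp.coeFn_smul _ _

lemma isSobolevTwo_wave (Γ : MetricGraph V E) (k : ℝ) (a : E ⊕ E → ℂ) (e : E) :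
    IsSobolevTwo (Γ.length e) (Γ.wave k a e) (Γ.waveDeriv k a e)
      ((-((k : ℂ) ^ 2 • Γ.waveL2 k a)) e) := by
  refine ⟨fun x hx => ?_, fun x hx => ?_⟩
  · rw [intervalIntegral.integral_eq_sub_of_hasDerivAt (fun y _ => hasDerivAt_wave Γ k a e y)
      ((continuous_waveDeriv Γ k a e).intervalIntegrable _ _)]
    ring
  · have hae : (-((k : ℂ) ^ 2 • Γ.waveL2 k a)) e =ᵐ[volume.restrict (Ioo 0 (Γ.length e))]
        fun x => -(k : ℂ) ^ 2 * Γ.wave k a e x := by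
      filter_upwards [coeFn_neg_sq_smul Γ k (Γ.waveL2 k a) e, coeFn_waveL2 Γ k a e] with y h1 h2
      rw [h1, h2]
    rw [integral_congr_Ioo hae hx,
      intervalIntegral.integral_eq_sub_of_hasDerivAt (fun y _ => hasDerivAt_waveDeriv Γ k a e y)
      ((continuous_const.mul (continuous_wave Γ k a e)).intervalIntegrable _ _)]
    ring

/-- Every solution of `-f'' = k² f` on an edge is a superposition of two plane waves. -/
lemma exists_eq_wave (Γ : MetricGraph V E) {k : ℝ} (hk : k ≠ 0) {Φ : Γ.L2} {f f' : E → ℝ → ℂ}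
    (hf : ∀ e, f e =ᵐ[volume.restrict (Ioo 0 (Γ.length e))] Φ e)
    (hf' : ∀ e, IsSobolevTwo (Γ.length e) (f e) (f' e) ((-((k : ℂ) ^ 2 • Φ)) e)) :
    ∃ a : E ⊕ E → ℂ, ∀ e, ∀ x ∈ Icc 0 (Γ.length e),
      f e x = Γ.wave k a e x ∧ f' e x = Γ.waveDeriv k a e x := by
  set c : ℂ := Complex.I * k with hc
  have hc0 : c ≠ 0 := mul_ne_zero Complex.I_ne_zero (by exact_mod_cast hk)
  have hc2 : c ^ 2 = -(k : ℂ) ^ 2 := by rw [hc, mul_pow, Complex.I_sq]; ring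
  -- From `2c f = (f' + c f) - (f' - c f)`. The second wave is normalised at the terminal end,
  -- whence the factor `exp (-c l)`.
  refine ⟨Sum.elim (fun e => (f' e 0 + c * f e 0) / (2 * c))
    (fun e => Complex.exp (-(c * Γ.length e)) * (-(f' e 0 - c * f e 0) / (2 * c))),
    fun e x hx => ?_⟩
  have hae : (-((k : ℂ) ^ 2 • Φ)) e =ᵐ[volume.restrict (Ioo 0 (Γ.length e))]
      fun x => c ^ 2 * f e x := by
    filter_upwards [coeFn_neg_sq_smul Γ k Φ e, hf e] with y h1 h2
    rw [h1, h2, hc2]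
  have h1 := (hf' e).add_mul_eq_exp (Γ.length_pos e) hae x hx
  have h2 := (hf' e).add_mul_eq_exp (c := -c) (Γ.length_pos e) (by simpa only [neg_sq] using hae)
    x hx
  simp only [neg_mul] at h2
  have h3 : Complex.exp (c * (Γ.length e - x)) = Complex.exp (c * Γ.length e) *
      Complex.exp (-(c * x)) := by rw [← Complex.exp_add]; ring_nf
  have h4 : Complex.exp (c * Γ.length e) * Complex.exp (-(c * Γ.length e)) = 1 := by
    rw [← Complex.exp_add, add_neg_cancel, Complex.exp_zero]
  simp only [MetricGraph.wave, MetricGraph.waveDeriv, Sum.elim_inl, Sum.elim_inr]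
  rw [← hc, h3]
  constructor
  · field_simp
    linear_combination h1 - h2 + Complex.exp (-(c * x)) * (f' e 0 - c * f e 0) * h4
  · field_simp
    linear_combination h1 + h2 - Complex.exp (-(c * x)) * (f' e 0 - c * f e 0) * h4

/-- A wave that is null in `L²` vanishes on each closed edge by continuity, as does its derivative;
their values at `0` determine both amplitudes. -/
lemma waveL2_injective (Γ : MetricGraph V E) {k : ℝ} (hk : k ≠ 0) :
    Function.Injective (Γ.waveL2 k) := by
  rw [← LinearMap.ker_eq_bot, LinearMap.ker_eq_bot']
  intro a ha
  have hkc : Complex.I * (k : ℂ) ≠ 0 := mul_ne_zero Complex.I_ne_zero (by exact_mod_cast hk)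
  have key : ∀ e, a (Sum.inl e) = 0 ∧ a (Sum.inr e) = 0 := by
    intro e
    have hl := Γ.length_pos e
    have h0 : (0 : ℝ) ∈ Icc 0 (Γ.length e) := left_mem_Icc.2 hl.le
    have hae : Γ.wave k a e =ᵐ[volume.restrict (Ioo 0 (Γ.length e))] 0 := by
      have h1 := coeFn_waveL2 Γ k a e
      rw [ha] at h1
      exact h1.symm.trans (Lp.coeFn_zero _ _ _)
    have hw : ∀ x ∈ Icc 0 (Γ.length e), Γ.wave k a e x = 0 := by
      refine eq_zero_of_primitive_eq_zero hl (continuous_wave Γ k a e).continuousOn fun x hx => ?_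
      rw [integral_congr_Ioo hae hx]
      simp
    have hw' : ∀ x ∈ Icc 0 (Γ.length e), Γ.waveDeriv k a e x = 0 := by
      refine eq_zero_of_primitive_eq_zero hl (continuous_waveDeriv Γ k a e).continuousOn
        fun x hx => ?_
      rw [intervalIntegral.integral_eq_sub_of_hasDerivAt (fun y _ => hasDerivAt_wave Γ k a e y)
        ((continuous_waveDeriv Γ k a e).intervalIntegrable _ _), hw x hx, hw 0 h0, sub_zero]
    have h1 := hw 0 h0
    have h2 := (mul_eq_zero.1 (hw' 0 h0)).resolve_left hkc
    simp only [MetricGraph.wave, Complex.ofReal_zero, mul_zero, Complex.exp_zero, mul_one,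
      sub_zero] at h1 h2
    have h3 : a (Sum.inl e) = 0 := by linear_combination (h1 + h2) / 2
    rw [h3, zero_add, mul_eq_zero] at h1
    exact ⟨h3, h1.resolve_right (Complex.exp_ne_zero _)⟩
  funext i
  rcases i with e | e
  exacts [(key e).1, (key e).2]

/-! ### Boundary conditions for plane waves and multiplicities of eigenvalues -/

variable [Fintype E] [DecidableEq E]

lemma T_mulVec_inl (Γ : MetricGraph V E) (k : ℂ) (a : E ⊕ E → ℂ) (e : E) :
    (Γ.T k).mulVec a (Sum.inl e) = Complex.exp (Complex.I * k * Γ.length e) * a (Sum.inr e) := by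
  rw [MetricGraph.T, Matrix.fromBlocks_mulVec]
  simp [MetricGraph.t, Matrix.mulVec_diagonal]

lemma T_mulVec_inr (Γ : MetricGraph V E) (k : ℂ) (a : E ⊕ E → ℂ) (e : E) :
    (Γ.T k).mulVec a (Sum.inr e) = Complex.exp (Complex.I * k * Γ.length e) * a (Sum.inl e) := by
  rw [MetricGraph.T, Matrix.fromBlocks_mulVec]
  simp [MetricGraph.t, Matrix.mulVec_diagonal]

lemma bv_wave (Γ : MetricGraph V E) (k : ℝ) (a : E ⊕ E → ℂ) :
    Γ.bv (Γ.wave k a) = a + (Γ.T k).mulVec a := by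
  funext i
  rcases i with e | e
  · simp [MetricGraph.bv, MetricGraph.wave, T_mulVec_inl, mul_comm]
  · simp [MetricGraph.bv, MetricGraph.wave, T_mulVec_inr, mul_comm, add_comm]

lemma bvDeriv_wave (Γ : MetricGraph V E) (k : ℝ) (a : E ⊕ E → ℂ) :
    Γ.bvDeriv (Γ.waveDeriv k a) = (Complex.I * k) • (a - (Γ.T k).mulVec a) := by
  funext i
  rcases i with e | e
  · simp only [MetricGraph.bvDeriv, MetricGraph.waveDeriv, Sum.elim_inl, Complex.ofReal_zero,
      mul_zero, Complex.exp_zero, sub_zero, Pi.smul_apply, Pi.sub_apply, T_mulVec_inl, smul_eq_mul]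
    ring
  · simp only [MetricGraph.bvDeriv, MetricGraph.waveDeriv, Sum.elim_inr, sub_self,
      mul_zero, Complex.exp_zero, Pi.smul_apply, Pi.sub_apply, T_mulVec_inr, smul_eq_mul]
    ring

/-- The boundary values are `a + T a` and `ik (a - T a)`, so the condition is `(A + ikB) a + (A -
ikB) T a = 0`. Factoring out the invertible `A + ikB` leaves `(1 - U) a = 0`. -/
lemma boundaryCondition_wave_iff (Γ : MetricGraph V E) (bc : BoundaryCondition E) {k : ℝ}
    (hk : k ≠ 0) (a : E ⊕ E → ℂ) :
    bc.A.mulVec (Γ.bv (Γ.wave k a)) + bc.B.mulVec (Γ.bvDeriv (Γ.waveDeriv k a)) = 0 ↔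
      (1 - U Γ bc k).mulVec a = 0 := by
  set C := bc.A + (Complex.I * k) • bc.B with hC
  have hu : IsUnit C := bc.isUnit_A_add_B (by simpa using hk)
  have hdet : IsUnit C.det := (Matrix.isUnit_iff_isUnit_det _).1 hu
  have h1 : bc.A.mulVec (Γ.bv (Γ.wave k a)) + bc.B.mulVec (Γ.bvDeriv (Γ.waveDeriv k a))
      = C.mulVec ((1 - U Γ bc k).mulVec a) := by
    have h2 : C * U Γ bc k = -((bc.A - (Complex.I * k) • bc.B) * Γ.T k) := by
      rw [U, BoundaryCondition.S, Matrix.neg_mul, Matrix.mul_neg, Matrix.mul_assoc,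
        Matrix.mul_nonsing_inv_cancel_left _ _ hdet]
    rw [Matrix.mulVec_mulVec, Matrix.mul_sub, Matrix.mul_one, h2, sub_neg_eq_add,
      Matrix.add_mulVec, ← Matrix.mulVec_mulVec, bv_wave, bvDeriv_wave, hC, Matrix.add_mulVec,
      Matrix.sub_mulVec, Matrix.smul_mulVec, Matrix.smul_mulVec, Matrix.mulVec_add,
      Matrix.mulVec_smul, Matrix.mulVec_sub, smul_sub (Complex.I * (k : ℂ))]
    abel
  rw [h1]
  refine ⟨fun h => ?_, fun h => by rw [h, Matrix.mulVec_zero]⟩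
  exact Matrix.mulVec_injective_of_isUnit hu (h.trans (Matrix.mulVec_zero _).symm)

lemma hasSecondDeriv_neg_sq_smul_iff (Γ : MetricGraph V E) (bc : BoundaryCondition E) {k : ℝ}
    (hk : k ≠ 0) (Φ : Γ.L2) :
    HasSecondDeriv Γ bc Φ (-((k : ℂ) ^ 2 • Φ)) ↔
      ∃ a, (1 - U Γ bc k).mulVec a = 0 ∧ Γ.waveL2 k a = Φ := by
  constructor
  · rintro ⟨f, f', hf, hf', hbc⟩
    obtain ⟨a, ha⟩ := exists_eq_wave Γ hk hf hf'
    have h0 : ∀ e, (0 : ℝ) ∈ Icc 0 (Γ.length e) := fun e => left_mem_Icc.2 (Γ.length_pos e).le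
    have hl : ∀ e, Γ.length e ∈ Icc 0 (Γ.length e) := fun e => right_mem_Icc.2 (Γ.length_pos e).le
    refine ⟨a, ?_, PiLp.ext fun e => Lp.ext ?_⟩
    · rw [← boundaryCondition_wave_iff Γ bc hk]
      have h1 : Γ.bv (Γ.wave k a) = Γ.bv f := by
        funext i
        rcases i with e | e
        · exact ((ha e 0 (h0 e)).1).symm
        · exact ((ha e _ (hl e)).1).symm
      have h2 : Γ.bvDeriv (Γ.waveDeriv k a) = Γ.bvDeriv f' := by
        funext i
        rcases i with e | e
        · exact ((ha e 0 (h0 e)).2).symm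
        · exact congrArg Neg.neg ((ha e _ (hl e)).2).symm
      rw [h1, h2, hbc]
    · refine (coeFn_waveL2 Γ k a e).trans (Filter.EventuallyEq.trans ?_ (hf e))
      exact (ae_restrict_iff' measurableSet_Ioo).2 (Filter.Eventually.of_forall fun x hx =>
        ((ha e x (Ioo_subset_Icc_self hx)).1).symm)
  · rintro ⟨a, ha, rfl⟩
    exact ⟨Γ.wave k a, Γ.waveDeriv k a, fun e => (coeFn_waveL2 Γ k a e).symm,
      isSobolevTwo_wave Γ k a, (boundaryCondition_wave_iff Γ bc hk a).2 ha⟩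

/-- The eigenspace of the Laplacian for `k²` is isomorphic to the fixed space of `U k`. -/
lemma nonempty_opEigenspace_equiv (Γ : MetricGraph V E) (bc : BoundaryCondition E) {k : ℝ}
    (hk : k ≠ 0) :
    Nonempty (LinearMap.ker (1 - U Γ bc k).mulVecLin ≃ₗ[ℂ]
      opEigenspace (laplacian Γ bc) ((k : ℂ) ^ 2)) := by
  -- The eigenspace consists of elements of the operator domain, so the two spaces are compared
  -- through their injective images in `L²(Γ)`.
  have hmap : (LinearMap.ker (1 - U Γ bc k).mulVecLin).map (Γ.waveL2 k) =
      (opEigenspace (laplacian Γ bc) ((k : ℂ) ^ 2)).map (laplacian Γ bc).domain.subtype := by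
    ext Φ
    have h1 : Φ ∈ (LinearMap.ker (1 - U Γ bc k).mulVecLin).map (Γ.waveL2 k) ↔
        HasSecondDeriv Γ bc Φ (-((k : ℂ) ^ 2 • Φ)) := by
      rw [hasSecondDeriv_neg_sq_smul_iff Γ bc hk]
      rfl
    have h2 : HasSecondDeriv Γ bc Φ (-((k : ℂ) ^ 2 • Φ)) ↔
        (Φ, (k : ℂ) ^ 2 • Φ) ∈ (laplacian Γ bc).graph := by
      rw [laplacian_graph]
      rfl
    rw [h1, h2, LinearPMap.mem_graph_iff, Submodule.mem_map]
    refine exists_congr fun x => ?_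
    rw [and_comm, opEigenspace, LinearMap.mem_ker, LinearMap.sub_apply, sub_eq_zero]
    refine and_congr_left fun hx => ?_
    subst hx
    rfl
  exact ⟨(Submodule.equivMapOfInjective _ (waveL2_injective Γ hk) _).trans
    ((LinearEquiv.ofEq _ _ hmap).trans
      (Submodule.equivMapOfInjective _ (Submodule.injective_subtype _) _).symm)⟩

lemma isEigenvalueOfMultiplicity_iff (Γ : MetricGraph V E) (bc : BoundaryCondition E) {k : ℝ}
    (hk : k ≠ 0) (g : ℕ) :
    IsEigenvalueOfMultiplicity (laplacian Γ bc) ((k : ℂ) ^ 2) g ↔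
      0 < g ∧ Module.finrank ℂ (LinearMap.ker (1 - U Γ bc k).mulVecLin) = g := by
  obtain ⟨φ⟩ := nonempty_opEigenspace_equiv Γ bc hk
  have hfin : FiniteDimensional ℂ (opEigenspace (laplacian Γ bc) ((k : ℂ) ^ 2)) :=
    Module.Finite.equiv φ
  rw [IsEigenvalueOfMultiplicity, φ.finrank_eq]
  have h := (Submodule.finrank_eq_zero (S := opEigenspace (laplacian Γ bc) ((k : ℂ) ^ 2))).not
  constructor
  · rintro ⟨h1, -, h2⟩
    exact ⟨h2 ▸ Nat.pos_of_ne_zero (h.2 h1), h2⟩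
  · rintro ⟨h1, h2⟩
    exact ⟨h.1 (h2 ▸ h1.ne'), hfin, h2⟩

lemma isZeroOfOrder_secularF_iff (Γ : MetricGraph V E) (bc : BoundaryCondition E)
    (hl : 2 / bc.lambdaPlusMin < Γ.lMin) {k : ℝ} (hk : k ≠ 0) (g : ℕ) :
    IsZeroOfOrder (secularF Γ bc) k g ↔
      IsEigenvalueOfMultiplicity (laplacian Γ bc) ((k : ℂ) ^ 2) g := by
  obtain ⟨h1, h2⟩ := analyticOrderAt_secularF Γ bc hl hk
  rw [isEigenvalueOfMultiplicity_iff Γ bc hk, IsZeroOfOrder, h2, Nat.cast_inj]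
  simp only [h1, true_and]

end QuantumGraph

theorem proposition3p6 {V E : Type*} [Fintype E] [DecidableEq E]
    (Γ : QuantumGraph.MetricGraph V E) (bc : QuantumGraph.BoundaryCondition E)
    (hl : 2 / bc.lambdaPlusMin < Γ.lMin) (k : ℝ) (hk : k ≠ 0) (g : ℕ) :
    List.TFAE [
      QuantumGraph.IsEigenvalueOfMultiplicity (QuantumGraph.laplacian Γ bc) ((k : ℂ) ^ 2) g,
      QuantumGraph.IsZeroOfOrder (QuantumGraph.secularF Γ bc) (k : ℂ) g,
      QuantumGraph.IsZeroOfOrder (QuantumGraph.secularF Γ bc) (-(k : ℂ)) g] := by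
  have h1 := QuantumGraph.isZeroOfOrder_secularF_iff Γ bc hl hk g
  -- No functional equation for `F` is needed: `-k` is also a nonzero real number with the same
  -- square. For `g = 0` all three conditions are false.
  have h2 := QuantumGraph.isZeroOfOrder_secularF_iff Γ bc hl (neg_ne_zero.2 hk) g
  rw [Complex.ofReal_neg, neg_sq] at h2
  tfae_have 2 ↔ 1 := h1
  tfae_have 3 ↔ 1 := h2
  tfae_finish
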